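/- For a positive integer $d$, a state is a positive semidefinite matrix $\rho\in\mathbb C^{d\times d}$ with $\operatorname{tr}\rho=1$, and $\|M\|_{\mathrm{tr}}=\operatorname{tr}\sqrt{M^\dagger M}$ is the trace norm. A finite family $(U_k)_{k\in K}$ of unitaries in $U(d)$ is called $\varepsilon$-randomizing if $$\Bigl\|\frac1{|K|}\sum_{k\in K}U_k\rho U_k^\dagger-\frac{\mathbb I}{d}\Bigr\|_{\mathrm{tr}}\le\varepsilon\qquad\text{for every state }\rho.$$ Let $\mathcal P_n$ be the set of $n$-qubit Pauli operators, i.e. all $\alpha\,\sigma_1\otimes\cdots\otimes\sigma_n$ with $\alpha\in\{\pm1,\pm i\}$ and each $\sigma_j\in\{\mathbb I,X,Y,Z\}$. (1) For every integer $d\ge1$, every $\varepsilon>0$ and every integer $m\ge1$ with $m\ge\frac{37d}{\varepsilon^2}\ln\frac{15}{\varepsilon}$, a sequence $U_1,\dots,U_m$ of unitaries drawn independently from the Haar probability measure on $U(d)$ is $\varepsilon$-randomizing with probability at least $1-e^{-d/2}$. (2) Consequently $\log_2 d+O(\log_2(1/\varepsilon))$ bits of key suffice: there is an absolute constant $C$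 such that for every $d\ge1$ and every $0<\varepsilon\le\frac12$ there are an integer $k\ge0$ with $k\le\log_2 d+C\log_2(1/\varepsilon)$ and an $\varepsilon$-randomizing family of unitaries in $U(d)$ indexed by the $k$-bit strings. (3) For $d=2^n$ (any integer $n\ge0$), the unitaries can be taken to be Pauli operators: (1) remains true if $U_1,\dots,U_m$ are drawn independently and uniformly from $\mathcal P_n$, and (2) remains true, with an absolute constant $C$, if all members of the family are required to lie in $\mathcal P_n$. -/

import Mathlib

open MeasureTheory ProbabilityTheory
open scoped ComplexOrder

noncomputable section

/-! ### States, trace norm, randomizing maps -/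

/-- The trace norm `tr √(Aᴴ A)`, i.e. the sum of the singular values of `A`, the square roots of the
eigenvalues (with multiplicity) of `Aᴴ A`. -/
def traceNorm {ι : Type*} [Fintype ι] [DecidableEq ι] (A : Matrix ι ι ℂ) : ℝ :=
  ∑ i, Real.sqrt ((Matrix.isHermitian_conjTranspose_mul_self A).eigenvalues i)

/-- A (possibly mixed) quantum state: a positive semidefinite matrix of trace one. -/
def IsState {ι : Type*} [Fintype ι] (ρ : Matrix ι ι ℂ) : Prop :=
  ρ.PosSemidef ∧ ρ.trace = 1

/-- The map `ρ ↦ (1/|κ|) ∑ k, U k ρ (U k)ᴴ` which applies a uniformly random member of the family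
`U` indexed by the set of keys `κ`. -/
def randomUnitaryChannel {ι κ : Type*} [Fintype ι] [DecidableEq ι] [Fintype κ]
    (U : κ → Matrix.unitaryGroup ι ℂ) (ρ : Matrix ι ι ℂ) : Matrix ι ι ℂ :=
  (1 / (Fintype.card κ : ℂ)) •
    ∑ k, (U k : Matrix ι ι ℂ) * ρ * (U k : Matrix ι ι ℂ).conjTranspose

/-- The family `U` of unitaries on `ℂ^ι` is `ε`-randomizing in trace norm: for every state `ρ` the
output of its channel is within `ε` of the totally mixed state `𝕀 / d`, where `d = |ι|`. -/
def IsRandomizing {ι κ : Type*} [Fintype ι] [DecidableEq ι] [Fintype κ]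
    (ε : ℝ) (U : κ → Matrix.unitaryGroup ι ℂ) : Prop :=
  ∀ ρ : Matrix ι ι ℂ, IsState ρ →
    traceNorm (randomUnitaryChannel U ρ - (1 / (Fintype.card ι : ℂ)) • 1) ≤ ε

/-! ### Haar measure on the unitary group -/

instance unitaryGroupCompactSpace (ι : Type*) [Fintype ι] [DecidableEq ι] :
    CompactSpace (Matrix.unitaryGroup ι ℂ) := by
  refine isCompact_iff_compactSpace.mp ?_
  have hK : IsCompact (Set.pi Set.univ fun _ : ι => Set.pi Set.univ fun _ : ι =>
      Metric.closedBall (0 : ℂ) 1) :=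
    isCompact_univ_pi fun _ => isCompact_univ_pi fun _ => isCompact_closedBall 0 1
  have hC : IsClosed ((Matrix.unitaryGroup ι ℂ : Set (Matrix ι ι ℂ))) := by
    have : (Matrix.unitaryGroup ι ℂ : Set (Matrix ι ι ℂ)) = {A | A * star A = 1} := by
      ext A
      exact Matrix.mem_unitaryGroup_iff
    rw [this]
    exact isClosed_eq (continuous_id.mul continuous_star) continuous_const
  refine IsCompact.of_isClosed_subset (X := ι → ι → ℂ) hK hC ?_
  intro A hA i _ j _
  simpa using entry_norm_bound_of_unitary hA i j

instance unitaryGroupMeasurableSpace (ι : Type*) [Fintype ι] [DecidableEq ι] :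
    MeasurableSpace (Matrix.unitaryGroup ι ℂ) :=
  borel _

instance unitaryGroupBorelSpace (ι : Type*) [Fintype ι] [DecidableEq ι] :
    BorelSpace (Matrix.unitaryGroup ι ℂ) :=
  ⟨rfl⟩

/-- The Haar measure on the compact group `U(d)`, normalized to total mass one. -/
def unitaryHaar (d : ℕ) : Measure (Matrix.unitaryGroup (Fin d) ℂ) :=
  Measure.haarMeasure ⊤

/-! ### Pauli operators on `n` qubits

The computational basis of `n` qubits is indexed by `Fin n → Fin 2`, of cardinality `2 ^ n`. -/

/-- The single-qubit Pauli matrices `𝕀, X, Y, Z`. -/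
def pauliMatrix : Fin 4 → Matrix (Fin 2) (Fin 2) ℂ :=
  ![!![1, 0; 0, 1], !![0, 1; 1, 0], !![0, -Complex.I; Complex.I, 0], !![1, 0; 0, -1]]

/-- The tensor product `σ_{s 0} ⊗ ⋯ ⊗ σ_{s (n-1)}` of single-qubit Pauli matrices. -/
def pauliString {n : ℕ} (s : Fin n → Fin 4) : Matrix (Fin n → Fin 2) (Fin n → Fin 2) ℂ :=
  Matrix.of fun x y => ∏ j, pauliMatrix (s j) (x j) (y j)

/-- The set of `n`-qubit Pauli operators: tensor products of `n` single-qubit Pauli matrices up to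
a phase `±1, ±i`. -/
def pauliOperators (n : ℕ) : Set (Matrix.unitaryGroup (Fin n → Fin 2) ℂ) :=
  {P | ∃ (a : Fin 4) (s : Fin n → Fin 4),
    (P : Matrix (Fin n → Fin 2) (Fin n → Fin 2) ℂ) = Complex.I ^ (a : ℕ) • pauliString s}

/-- The uniform distribution on the `n`-qubit Pauli operators. -/
def uniformPauli (n : ℕ) : Measure (Matrix.unitaryGroup (Fin n → Fin 2) ℂ) :=
  uniformOn (pauliOperators n)

end

/-! The argument combines a small mean, concentration for each fixed state, and a union bound over a
net.

By convexity only pure states `ψ` matter. Let `D = pureDeviation ψ U` be the trace distance from the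
output on `ψ` to the totally mixed state. Both the Haar measure and the uniform Pauli measure are
1-designs, so the channel output is an average of `m` independent matrices whose mean is the totally
mixed state. Each has Hilbert–Schmidt norm 1, so the mean square Hilbert–Schmidt deviation is at
most `1/m`. As the squared trace norm is at most `d` times the squared Hilbert–Schmidt norm, the
mean of `D` is at most `√(d/m)` (`integral_pureDeviation_le`).

Replacing one unitary moves `D` by at most `2/m`. McDiarmid's inequality then gives a tail `exp(-δ²
m / 2)` above the mean (`measure_pureDeviation_ge_le`). Since `D` is 2-Lipschitz in `ψ`, control on
a net of the unit sphere is enough. That sphere has real dimension less than `2d`, so a net has at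
most `exp(2 d ln(15/ε))` points, and the tail beats this number (`measure_isRandomizing_ge`).

The key length statements follow because an event of positive probability is nonempty. The argument
sees the measure only through the 1-design property, which is derived from left invariance under a
few diagonal and permutation-like unitaries (`isOneDesign_of_invariant`). -/

noncomputable section

/-! ### The trace norm via duality with unitaries -/

section TraceNorm

/-- The matrix `|u⟩⟨w|`. -/
def ketBra {ι : Type*} (u w : EuclideanSpace ℂ ι) : Matrix ι ι ℂ :=
  Matrix.of fun i j => u i * star (w j)

@[simp] lemma ketBra_apply {ι : Type*} (u w : EuclideanSpace ℂ ι) (i j : ι) :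
    ketBra u w i j = u i * star (w j) := rfl

variable {ι : Type*} [Fintype ι] [DecidableEq ι]

/-- Moving one `A` across the inner product leaves `Aᴴ A` acting on its own eigenvectors. Hence `A`
sends this basis to orthogonal vectors whose lengths are the singular values. -/
lemma inner_toEuclideanLin_eigenvectorBasis (A : Matrix ι ι ℂ) (i j : ι) :
    let H := Matrix.isHermitian_conjTranspose_mul_self A
    inner ℂ (Matrix.toEuclideanLin A (H.eigenvectorBasis i))
      (Matrix.toEuclideanLin A (H.eigenvectorBasis j)) =
      if i = j then (H.eigenvalues j : ℂ) else 0 := by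
  intro H
  have h : Matrix.toEuclideanLin A.conjTranspose
      (Matrix.toEuclideanLin A (H.eigenvectorBasis j)) =
        (H.eigenvalues j : ℂ) • H.eigenvectorBasis j := by
    have h1 := H.mulVec_eigenvectorBasis j
    rw [← Matrix.mulVec_mulVec] at h1
    ext k
    simpa [Matrix.toLpLin_apply] using congrFun h1 k
  rw [← LinearMap.adjoint_inner_right, ← Matrix.toEuclideanLin_conjTranspose_eq_adjoint, h,
    inner_smul_right, H.eigenvectorBasis.inner_eq_ite]
  split_ifs <;> simp

lemma norm_toEuclideanLin_eigenvectorBasis (A : Matrix ι ι ℂ) (i : ι) :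
    ‖Matrix.toEuclideanLin A
      ((Matrix.isHermitian_conjTranspose_mul_self A).eigenvectorBasis i)‖ =
      √((Matrix.isHermitian_conjTranspose_mul_self A).eigenvalues i) := by
  rw [@norm_eq_sqrt_re_inner ℂ, inner_toEuclideanLin_eigenvectorBasis]
  simp

lemma traceNorm_nonneg (A : Matrix ι ι ℂ) : 0 ≤ traceNorm A :=
  Finset.sum_nonneg fun _ _ => Real.sqrt_nonneg _

/-- The trace norm dominates the pairing with any contraction. -/
lemma norm_trace_comp_le_traceNorm (A : Matrix ι ι ℂ)
    (M : EuclideanSpace ℂ ι →ₗ[ℂ] EuclideanSpace ℂ ι) (hM : ∀ x, ‖M x‖ ≤ ‖x‖) :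
    ‖LinearMap.trace ℂ _ (M ∘ₗ Matrix.toEuclideanLin A)‖ ≤ traceNorm A := by
  rw [LinearMap.trace_eq_sum_inner _
    (Matrix.isHermitian_conjTranspose_mul_self A).eigenvectorBasis]
  refine (norm_sum_le _ _).trans (Finset.sum_le_sum fun i _ => ?_)
  refine (norm_inner_le_norm _ _).trans ?_
  rw [OrthonormalBasis.norm_eq_one, one_mul, LinearMap.comp_apply,
    ← norm_toEuclideanLin_eigenvectorBasis]
  exact hM _

/-- The trace norm is attained as the pairing with some unitary. -/
lemma exists_trace_comp_eq_traceNorm (A : Matrix ι ι ℂ) :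
    ∃ M : EuclideanSpace ℂ ι ≃ₗᵢ[ℂ] EuclideanSpace ℂ ι,
      LinearMap.trace ℂ _ (M.toLinearEquiv.toLinearMap ∘ₗ Matrix.toEuclideanLin A) =
        (traceNorm A : ℂ) := by
  set H := Matrix.isHermitian_conjTranspose_mul_self A
  set q := H.eigenvectorBasis
  set f := Matrix.toEuclideanLin A
  have hn : ∀ i, ‖f (q i)‖ = √(H.eigenvalues i) := norm_toEuclideanLin_eigenvectorBasis A
  set v : ι → EuclideanSpace ℂ ι := fun i => ((‖f (q i)‖⁻¹ : ℝ) : ℂ) • f (q i)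
  set s : Set ι := {i | f (q i) ≠ 0}
  have hv : Orthonormal ℂ (s.domRestrict v) := by
    constructor
    · rintro ⟨i, hi⟩
      have : ‖f (q i)‖ ≠ 0 := norm_ne_zero_iff.mpr hi
      simp [v, norm_smul, this]
    · rintro ⟨i, hi⟩ ⟨j, hj⟩ hij
      have hne : i ≠ j := fun h => hij (Subtype.ext h)
      have : inner ℂ (f (q i)) (f (q j)) = 0 :=
        (inner_toEuclideanLin_eigenvectorBasis A i j).trans (if_neg hne)
      change inner ℂ (v i) (v j) = 0
      simp only [v, inner_smul_left, inner_smul_right, this, mul_zero]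
  -- The normalized nonzero images are completed to an orthonormal basis `b`, giving a singular
  -- value decomposition. The unitary taking `b i` to `q i` is the inverse of a polar factor of `A`.
  obtain ⟨b, hb⟩ := hv.exists_orthonormalBasis_extension_of_card_eq (by simp)
  have hf : ∀ i, f (q i) = ((√(H.eigenvalues i) : ℝ) : ℂ) • b i := by
    intro i
    by_cases hi : f (q i) = 0
    · rw [← hn i, hi]; simp
    · rw [hb i hi, ← hn i]
      have : (‖f (q i)‖ : ℂ) ≠ 0 := by simpa using hi
      simp [v, smul_smul, this]
  refine ⟨b.equiv q (Equiv.refl ι), ?_⟩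
  rw [LinearMap.trace_eq_sum_inner _ q, traceNorm, Complex.ofReal_sum]
  refine Finset.sum_congr rfl fun i _ => ?_
  simp only [LinearMap.comp_apply]
  rw [hf i, map_smul, inner_smul_right]
  simp

/-- The unitary optimal for `A + B` is merely admissible for `A` and for `B`. -/
lemma traceNorm_add_le (A B : Matrix ι ι ℂ) :
    traceNorm (A + B) ≤ traceNorm A + traceNorm B := by
  obtain ⟨M, hM⟩ := exists_trace_comp_eq_traceNorm (A + B)
  have h := congrArg norm hM
  rw [map_add, LinearMap.comp_add, map_add, Complex.norm_real, Real.norm_eq_abs,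
    abs_of_nonneg (traceNorm_nonneg _)] at h
  rw [← h]
  refine (norm_add_le _ _).trans (add_le_add ?_ ?_) <;>
  exact norm_trace_comp_le_traceNorm _ _ fun x => (M.norm_map x).le

lemma traceNorm_smul_le (c : ℂ) (A : Matrix ι ι ℂ) :
    traceNorm (c • A) ≤ ‖c‖ * traceNorm A := by
  obtain ⟨M, hM⟩ := exists_trace_comp_eq_traceNorm (c • A)
  have h := congrArg norm hM
  rw [map_smul, LinearMap.comp_smul, map_smul, Complex.norm_real, Real.norm_eq_abs,
    abs_of_nonneg (traceNorm_nonneg _), norm_smul] at h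
  rw [← h]
  exact mul_le_mul_of_nonneg_left
    (norm_trace_comp_le_traceNorm _ _ fun x => (M.norm_map x).le) (norm_nonneg _)

lemma traceNorm_neg_le (A : Matrix ι ι ℂ) : traceNorm (-A) ≤ traceNorm A := by
  simpa using traceNorm_smul_le (-1) A

lemma traceNorm_sub_comm (A B : Matrix ι ι ℂ) : traceNorm (A - B) = traceNorm (B - A) :=
  le_antisymm (by simpa using traceNorm_neg_le (B - A)) (by simpa using traceNorm_neg_le (A - B))

lemma traceNorm_sub_le (A B : Matrix ι ι ℂ) :
    traceNorm (A - B) ≤ traceNorm A + traceNorm B := by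
  rw [sub_eq_add_neg]
  exact (traceNorm_add_le _ _).trans (add_le_add le_rfl (traceNorm_neg_le B))

@[simp] lemma traceNorm_zero : traceNorm (0 : Matrix ι ι ℂ) = 0 :=
  le_antisymm (by simpa using traceNorm_smul_le 0 (0 : Matrix ι ι ℂ)) (traceNorm_nonneg _)

lemma traceNorm_sum_le {κ : Type*} (s : Finset κ) (A : κ → Matrix ι ι ℂ) :
    traceNorm (∑ k ∈ s, A k) ≤ ∑ k ∈ s, traceNorm (A k) :=
  Finset.le_sum_of_subadditive traceNorm traceNorm_zero.le traceNorm_add_le s A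

lemma abs_traceNorm_sub_le (A B : Matrix ι ι ℂ) :
    |traceNorm A - traceNorm B| ≤ traceNorm (A - B) := by
  have h1 := traceNorm_add_le (A - B) B
  have h2 := traceNorm_add_le (B - A) A
  rw [sub_add_cancel] at h1 h2
  rw [traceNorm_sub_comm B A] at h2
  exact abs_le.mpr ⟨by linarith, by linarith⟩

lemma toEuclideanLin_ketBra (u w x : EuclideanSpace ℂ ι) :
    Matrix.toEuclideanLin (ketBra u w) x = inner ℂ w x • u := by
  ext i
  simp [Matrix.toLpLin_apply, Matrix.mulVec, dotProduct, PiLp.inner_apply, Finset.sum_mul]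
  exact Finset.sum_congr rfl fun j _ => by ring

lemma traceNorm_ketBra_le (u w : EuclideanSpace ℂ ι) :
    traceNorm (ketBra u w) ≤ ‖u‖ * ‖w‖ := by
  obtain ⟨M, hM⟩ := exists_trace_comp_eq_traceNorm (ketBra u w)
  have h : LinearMap.trace ℂ _ (M.toLinearEquiv.toLinearMap ∘ₗ Matrix.toEuclideanLin (ketBra u w))
      = inner ℂ w (M u) := by
    rw [LinearMap.trace_eq_sum_inner _ (EuclideanSpace.basisFun ι ℂ)]
    simp only [LinearMap.comp_apply, toEuclideanLin_ketBra, map_smul, inner_smul_right]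
    exact (EuclideanSpace.basisFun ι ℂ).sum_inner_mul_inner w (M u)
  rw [h] at hM
  have h2 := congrArg norm hM
  rw [Complex.norm_real, Real.norm_eq_abs, abs_of_nonneg (traceNorm_nonneg _)] at h2
  rw [← h2, mul_comm, ← M.norm_map u]
  exact norm_inner_le_norm _ _

/-- Comparison of the trace norm with the Hilbert–Schmidt norm. -/
lemma traceNorm_sq_le (A : Matrix ι ι ℂ) :
    traceNorm A ^ 2 ≤ Fintype.card ι * ∑ i, ∑ j, ‖A i j‖ ^ 2 := by
  have hnn : ∀ i, 0 ≤ (Matrix.isHermitian_conjTranspose_mul_self A).eigenvalues i :=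
    (Matrix.posSemidef_conjTranspose_mul_self A).eigenvalues_nonneg
  have h1 := sq_sum_le_card_mul_sum_sq (s := (Finset.univ : Finset ι))
    (f := fun i => √((Matrix.isHermitian_conjTranspose_mul_self A).eigenvalues i))
  refine h1.trans (le_of_eq ?_)
  simp only [Finset.card_univ, Real.sq_sqrt (hnn _)]
  congr 1
  have h2 := (Matrix.isHermitian_conjTranspose_mul_self A).trace_eq_sum_eigenvalues
  have h3 : (A.conjTranspose * A).trace = ((∑ i, ∑ j, ‖A i j‖ ^ 2 : ℝ) : ℂ) := by
    rw [Finset.sum_comm]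
    simp [Matrix.trace, Matrix.mul_apply, Complex.conj_mul']
  rw [h3] at h2
  have h4 : ((∑ i, ∑ j, ‖A i j‖ ^ 2 : ℝ) : ℂ) =
    ((∑ i, (Matrix.isHermitian_conjTranspose_mul_self A).eigenvalues i : ℝ) : ℂ) := by
    rw [h2]; simp
  exact (Complex.ofReal_injective h4).symm

/-- The variation of the trace norm is dominated by the Hilbert–Schmidt norm of the difference,
which is visibly continuous in the entries. -/
lemma continuous_traceNorm : Continuous (traceNorm : Matrix ι ι ℂ → ℝ) := by
  rw [continuous_iff_continuousAt]
  intro B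
  rw [ContinuousAt, tendsto_iff_dist_tendsto_zero]
  have hc : Continuous fun A : Matrix ι ι ℂ =>
      √(Fintype.card ι * ∑ i, ∑ j, ‖(A - B) i j‖ ^ 2) := by
    simp only [Matrix.sub_apply]
    fun_prop
  have h0 : (√(Fintype.card ι * ∑ i, ∑ j, ‖(B - B) i j‖ ^ 2) : ℝ) = 0 := by simp
  refine squeeze_zero (fun _ => dist_nonneg) (fun A => ?_) (h0 ▸ hc.tendsto B)
  rw [Real.dist_eq]
  refine (abs_traceNorm_sub_le A B).trans ?_
  exact Real.le_sqrt_of_sq_le (traceNorm_sq_le _)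

end TraceNorm

/-! ### Nets of the unit sphere -/

section Net

variable {E : Type*} [NormedAddCommGroup E] [NormedSpace ℝ E] [FiniteDimensional ℝ E]

/-- Volumetric bound on the size of a separated subset of the unit ball. -/
lemma card_le_of_separated_unit_ball {r : ℝ} (hr : 0 < r) (s : Finset E)
    (hs : ∀ c ∈ s, ‖c‖ ≤ 1) (h : ∀ c ∈ s, ∀ d ∈ s, c ≠ d → r ≤ ‖c - d‖) :
    (s.card : ℝ) ≤ (1 + 2 / r) ^ Module.finrank ℝ E := by
  borelize E
  let μ : Measure E := Measure.addHaar
  have hδ : 0 < r / 2 := by positivity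
  have hρ : 0 < 1 + r / 2 := by positivity
  have hdisj : Set.Pairwise (s : Set E)
      (Function.onFun Disjoint fun c => Metric.ball (c : E) (r / 2)) := by
    rintro c hc d hd hcd
    apply Metric.ball_disjoint_ball
    rw [dist_eq_norm]
    linarith [h c hc d hd hcd]
  have hsub : (⋃ c ∈ s, Metric.ball (c : E) (r / 2)) ⊆ Metric.ball (0 : E) (1 + r / 2) := by
    refine Set.iUnion₂_subset fun x hx => Metric.ball_subset_ball' ?_
    rw [dist_zero_right]
    linarith [hs x hx]
  have hI : (s.card : ENNReal) * ENNReal.ofReal ((r / 2) ^ Module.finrank ℝ E) *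
      μ (Metric.ball 0 1) ≤
      ENNReal.ofReal ((1 + r / 2) ^ Module.finrank ℝ E) * μ (Metric.ball 0 1) := by
    have := measure_mono (μ := μ) hsub
    rw [measure_biUnion_finset hdisj fun c _ => measurableSet_ball] at this
    simpa only [μ.addHaar_ball_of_pos _ hδ, μ.addHaar_ball_of_pos _ hρ, Finset.sum_const,
      nsmul_eq_mul, mul_assoc] using this
  have hJ := (ENNReal.mul_le_mul_iff_left
    (Metric.measure_ball_pos μ (0 : E) zero_lt_one).ne' measure_ball_lt_top.ne).1 hI
  have hK := ENNReal.toReal_le_of_le_ofReal (by positivity) hJ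
  rw [ENNReal.toReal_mul, ENNReal.toReal_ofReal (by positivity), ENNReal.toReal_natCast] at hK
  have hsplit : (1 + 2 / r) ^ Module.finrank ℝ E =
      (1 + r / 2) ^ Module.finrank ℝ E / (r / 2) ^ Module.finrank ℝ E := by
    rw [← div_pow]
    congr 1
    field_simp
    ring
  rw [hsplit, le_div_iff₀ (by positivity)]
  exact hK

/-- A separated set of largest cardinality exists by the volumetric bound. It is a net, since any
point farther than `r` from it could be added. -/
lemma exists_unit_sphere_net (E : Type*) [NormedAddCommGroup E] [NormedSpace ℝ E]
    [FiniteDimensional ℝ E] {r : ℝ} (hr : 0 < r) :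
    ∃ s : Finset E, (∀ c ∈ s, ‖c‖ = 1) ∧ (∀ x : E, ‖x‖ = 1 → ∃ c ∈ s, ‖x - c‖ ≤ r) ∧
      (s.card : ℝ) ≤ (1 + 2 / r) ^ Module.finrank ℝ E := by
  classical
  let P : Finset E → Prop := fun s =>
    (∀ c ∈ s, ‖c‖ = 1) ∧ ∀ c ∈ s, ∀ d ∈ s, c ≠ d → r ≤ ‖c - d‖
  have hP : ∀ s, P s → (s.card : ℝ) ≤ (1 + 2 / r) ^ Module.finrank ℝ E := fun s hs =>
    card_le_of_separated_unit_ball hr s (fun c hc => (hs.1 c hc).le) hs.2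
  let K : Set ℕ := {k | ∃ s, P s ∧ s.card = k}
  have hne : K.Nonempty := ⟨0, ∅, by simp [P], rfl⟩
  have hbdd : BddAbove K := by
    refine ⟨⌊(1 + 2 / r) ^ Module.finrank ℝ E⌋₊, ?_⟩
    rintro _ ⟨s, hs, rfl⟩
    exact Nat.le_floor (hP s hs)
  obtain ⟨s, hs, hcard⟩ := Nat.sSup_mem hne hbdd
  refine ⟨s, hs.1, fun x hx => ?_, hP s hs⟩
  by_contra! hcon
  have hxs : x ∉ s := fun hxs => by
    have := hcon x hxs
    simp at this
    linarith
  have hins : P (insert x s) := by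
    refine ⟨by simpa [hx] using hs.1, ?_⟩
    intro c hc d hd hcd
    rw [Finset.mem_insert] at hc hd
    rcases hc with rfl | hc <;> rcases hd with rfl | hd
    · exact absurd rfl hcd
    · exact (hcon d hd).le
    · rw [norm_sub_rev]
      exact (hcon c hc).le
    · exact hs.2 c hc d hd hcd
  have := le_csSup hbdd ⟨_, hins, rfl⟩
  rw [Finset.card_insert_of_notMem hxs, hcard] at this
  omega

end Net

/-! ### McDiarmid's inequality -/

section BoundedDifferences

variable {Ω : Type*} [MeasurableSpace Ω] {ν : Measure Ω} [IsProbabilityMeasure ν]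

/-- Hoeffding's lemma for a function of bounded oscillation. -/
lemma hasSubgaussianMGF_of_oscillation_le {h : Ω → ℝ} (hm : Measurable h) {c : NNReal}
    (hc : ∀ y z, h y - h z ≤ c) :
    HasSubgaussianMGF (fun y => h y - ∫ z, h z ∂ν) ((c / 2) ^ 2) ν := by
  have : Nonempty Ω := nonempty_of_isProbabilityMeasure ν
  have hbdd : BddBelow (Set.range h) := by
    obtain ⟨y₀⟩ := this
    refine ⟨h y₀ - c, ?_⟩
    rintro _ ⟨z, rfl⟩
    linarith [hc y₀ z]
  have key := hasSubgaussianMGF_of_mem_Icc (μ := ν) (X := h) (a := ⨅ y, h y)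
    (b := (⨅ y, h y) + c) hm.aemeasurable (Filter.Eventually.of_forall fun y =>
      ⟨ciInf_le hbdd y, by
        have : h y - c ≤ ⨅ z, h z := le_ciInf fun z => by linarith [hc y z]
        linarith⟩)
  simpa using key

lemma integral_pi_fin_succ {m : ℕ} {F : (Fin (m + 1) → Ω) → ℝ}
    (hF : Integrable F (Measure.pi fun _ => ν)) :
    ∫ x, F x ∂(Measure.pi fun _ => ν) =
      ∫ x, ∫ y, F (Fin.cons y x) ∂ν ∂(Measure.pi fun _ : Fin m => ν) := by
  have hmp := (measurePreserving_piFinSuccAbove (fun _ : Fin (m + 1) => ν) 0).symm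
  rw [← hmp.integral_comp' F, integral_prod_symm]
  · have h : ∀ (x : Fin m → Ω) (y : Ω),
        (MeasurableEquiv.piFinSuccAbove (fun _ : Fin (m + 1) => Ω) 0).symm (y, x) =
          Fin.cons y x := fun x y => Fin.insertNth_zero' y x
    simp only [h]
  · exact hmp.integrable_comp_of_integrable hF

lemma integrable_of_measurable_of_abs_le {α : Type*} [MeasurableSpace α] {μ : Measure α}
    [IsFiniteMeasure μ] {f : α → ℝ} (hf : Measurable f) {B : ℝ} (hB : ∀ x, |f x| ≤ B) :
    Integrable f μ :=
  Integrable.of_bound hf.aestronglyMeasurable B (Filter.Eventually.of_forall hB)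

/-- **McDiarmid's inequality** in sub-Gaussian form: a bounded function of `m` independent
identically distributed variables whose value changes by at most `c` when one variable is changed
is sub-Gaussian with parameter `m (c / 2)²`. -/
lemma hasSubgaussianMGF_of_bounded_differences (c : NNReal) :
    ∀ (m : ℕ) (f : (Fin m → Ω) → ℝ), Measurable f → (∃ B, ∀ x, |f x| ≤ B) →
      (∀ i x a, f (Function.update x i a) - f x ≤ c) →
      HasSubgaussianMGF (fun x => f x - ∫ z, f z ∂(Measure.pi fun _ => ν)) (m * (c / 2) ^ 2)
        (Measure.pi fun _ => ν) := by
  intro m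
  induction m with
  | zero =>
    intro f _ _ _
    have h0 : (fun x => f x - ∫ z, f z ∂(Measure.pi fun _ : Fin 0 => ν)) = fun _ => 0 := by
      funext x
      have : f = fun _ => f x := by
        funext y
        rw [Subsingleton.elim y x]
      rw [this]
      simp
    rw [h0]
    simp
  | succ m ih =>
    rintro f hf ⟨B, hB⟩ hc
    have hcons : Measurable fun p : (Fin m → Ω) × Ω => (Fin.cons p.2 p.1 : Fin (m + 1) → Ω) := by
      rw [measurable_pi_iff]
      intro i
      refine Fin.cases ?_ (fun j => ?_) i
      · simpa using measurable_snd
      · simpa using measurable_fst.eval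
    have hfc : Measurable fun p : (Fin m → Ω) × Ω => f (Fin.cons p.2 p.1) := hf.comp hcons
    have hfx : ∀ x : Fin m → Ω, Measurable fun y => f (Fin.cons y x) := fun x =>
      hfc.comp measurable_prodMk_left
    have hfi : ∀ x : Fin m → Ω, Integrable (fun y => f (Fin.cons y x)) ν := fun x =>
      integrable_of_measurable_of_abs_le (hfx x) fun _ => hB _
    -- Integrating out the first coordinate splits `f - e` as `(f - g) + (g - e)`. Hoeffding's lemma
    -- handles the first term conditionally on the other coordinates, and induction handles the
    -- second.
    set g : (Fin m → Ω) → ℝ := fun x => ∫ y, f (Fin.cons y x) ∂ν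
    have hg : Measurable g := hfc.stronglyMeasurable.integral_prod_right'.measurable
    have hgB : ∀ x, |g x| ≤ B := fun x => by
      have := norm_integral_le_of_norm_le_const (μ := ν) (C := B)
        (f := fun y => f (Fin.cons y x))
        (Filter.Eventually.of_forall fun y => hB (Fin.cons y x))
      simpa using this
    have hgc : ∀ i x a, g (Function.update x i a) - g x ≤ c := fun i x a => by
      rw [← integral_sub (hfi _) (hfi _)]
      have : ∫ _ : Ω, (c : ℝ) ∂ν = c := by simp
      rw [← this]
      refine integral_mono ((hfi _).sub (hfi _)) (integrable_const _) fun y => ?_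
      simp only [Fin.cons_update]
      exact hc _ _ _
    have hEg : ∫ x, f x ∂(Measure.pi fun _ : Fin (m + 1) => ν) =
        ∫ x, g x ∂(Measure.pi fun _ : Fin m => ν) :=
      integral_pi_fin_succ (integrable_of_measurable_of_abs_le hf hB)
    have IH := ih g hg ⟨B, hgB⟩ hgc
    rw [hEg]
    set e := ∫ x, g x ∂(Measure.pi fun _ : Fin m => ν)
    have hexp : ∀ t : ℝ, Integrable (fun x => Real.exp (t * (f x - e)))
        (Measure.pi fun _ : Fin (m + 1) => ν) := fun t => by
      refine integrable_of_measurable_of_abs_le (B := Real.exp (|t| * (B + |e|))) (by fun_prop)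
        fun x => ?_
      rw [abs_of_pos (Real.exp_pos _), Real.exp_le_exp]
      refine (le_abs_self _).trans ?_
      rw [abs_mul]
      gcongr
      exact (abs_sub _ _).trans (by gcongr; exact hB x)
    refine ⟨hexp, fun t => ?_⟩
    have hosc : ∀ x : Fin m → Ω, HasSubgaussianMGF (fun y => f (Fin.cons y x) - g x)
        ((c / 2) ^ 2) ν := fun x => by
      refine hasSubgaussianMGF_of_oscillation_le (hfx x) fun y z => ?_
      have := hc 0 (Fin.cons z x) y
      simpa [Fin.update_cons_zero] using this
    have hinner : ∀ x : Fin m → Ω, ∫ y, Real.exp (t * (f (Fin.cons y x) - e)) ∂ν ≤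
        Real.exp (((c / 2) ^ 2 : NNReal) * t ^ 2 / 2) * Real.exp (t * (g x - e)) := fun x => by
      have h1 := (hosc x).mgf_le t
      rw [mgf] at h1
      calc ∫ y, Real.exp (t * (f (Fin.cons y x) - e)) ∂ν
          = ∫ y, Real.exp (t * (f (Fin.cons y x) - g x)) * Real.exp (t * (g x - e)) ∂ν := by
            congr 1 with y
            rw [← Real.exp_add]
            ring_nf
        _ = (∫ y, Real.exp (t * (f (Fin.cons y x) - g x)) ∂ν) * Real.exp (t * (g x - e)) :=
            integral_mul_const _ _
        _ ≤ _ := by gcongr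
    have hout := IH.mgf_le t
    rw [mgf] at hout ⊢
    rw [integral_pi_fin_succ (hexp t)]
    calc ∫ x, ∫ y, Real.exp (t * (f (Fin.cons y x) - e)) ∂ν ∂(Measure.pi fun _ : Fin m => ν)
        ≤ ∫ x, Real.exp (((c / 2) ^ 2 : NNReal) * t ^ 2 / 2) * Real.exp (t * (g x - e))
            ∂(Measure.pi fun _ : Fin m => ν) :=
          integral_mono_of_nonneg
            (Filter.Eventually.of_forall fun x => integral_nonneg fun y => (Real.exp_pos _).le)
            ((IH.integrable_exp_mul t).const_mul _) (Filter.Eventually.of_forall hinner)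
      _ = Real.exp (((c / 2) ^ 2 : NNReal) * t ^ 2 / 2) *
            ∫ x, Real.exp (t * (g x - e)) ∂(Measure.pi fun _ : Fin m => ν) :=
          integral_const_mul _ _
      _ ≤ Real.exp (((c / 2) ^ 2 : NNReal) * t ^ 2 / 2) *
            Real.exp ((m * (c / 2) ^ 2 : NNReal) * t ^ 2 / 2) := by gcongr
      _ = _ := by
          rw [← Real.exp_add]
          push_cast
          ring_nf

end BoundedDifferences

/-! ### Second moments of empirical averages -/

section Average

variable {Ω : Type*} [MeasurableSpace Ω] {ν : Measure Ω} [IsProbabilityMeasure ν]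

/-- The mean square deviation of an empirical average from its expectation. -/
lemma integral_sq_average_sub_le {a : Ω → ℝ} (ha : Measurable a) {B : ℝ} (hB : ∀ x, |a x| ≤ B)
    {m : ℕ} (hm : 1 ≤ m) :
    ∫ x, ((1 / (m : ℝ)) * ∑ k, a (x k) - ∫ y, a y ∂ν) ^ 2 ∂(Measure.pi fun _ : Fin m => ν) ≤
      (∫ y, a y ^ 2 ∂ν) / m := by
  have hm0 : (m : ℝ) ≠ 0 := by positivity
  have hL : MemLp a 2 ν :=
    MemLp.of_bound ha.aestronglyMeasurable B (Filter.Eventually.of_forall hB)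
  have hi : ∀ k : Fin m, Integrable (fun x : Fin m → Ω => a (x k)) (Measure.pi fun _ => ν) :=
    fun k => integrable_of_measurable_of_abs_le (by fun_prop) fun _ => hB _
  have hv := variance_sum_pi (μ := fun _ : Fin m => ν) (X := fun _ => a) fun _ => hL
  have hE : ∫ x, ∑ k, a (x k) ∂(Measure.pi fun _ : Fin m => ν) = m * ∫ y, a y ∂ν := by
    rw [integral_finsetSum _ fun k _ => hi k]
    have : ∀ k : Fin m, ∫ x, a (x k) ∂(Measure.pi fun _ : Fin m => ν) = ∫ y, a y ∂ν := fun k =>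
      integral_comp_eval (μ := fun _ : Fin m => ν) (i := k) (f := a) ha.aestronglyMeasurable
    simp [this]
  have hsum : (∑ k : Fin m, fun x : Fin m → Ω => a (x k)) = fun x => ∑ k, a (x k) := by
    ext x
    simp
  have hsm : Measurable fun x : Fin m → Ω => ∑ k, a (x k) :=
    Finset.measurable_sum _ fun k _ => ha.comp (measurable_pi_apply k)
  rw [hsum, variance_eq_integral hsm.aemeasurable, hE] at hv
  have hvar : Var[a; ν] ≤ ∫ y, a y ^ 2 ∂ν := by
    rw [variance_eq_sub hL]
    simp only [Pi.pow_apply]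
    linarith [sq_nonneg (∫ y, a y ∂ν)]
  calc ∫ x, ((1 / (m : ℝ)) * ∑ k, a (x k) - ∫ y, a y ∂ν) ^ 2 ∂(Measure.pi fun _ : Fin m => ν)
      = ∫ x, (1 / (m : ℝ)) ^ 2 * (∑ k, a (x k) - m * ∫ y, a y ∂ν) ^ 2
          ∂(Measure.pi fun _ : Fin m => ν) := by
        congr 1 with x
        field_simp
    _ = (1 / (m : ℝ)) ^ 2 * (m * Var[a; ν]) := by
        rw [integral_const_mul, hv]
        simp
    _ = Var[a; ν] / m := by field_simp
    _ ≤ _ := by gcongr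

lemma sq_integral_le_integral_sq {f : Ω → ℝ} (hf : Measurable f) {B : ℝ}
    (hB : ∀ x, |f x| ≤ B) : (∫ x, f x ∂ν) ^ 2 ≤ ∫ x, f x ^ 2 ∂ν := by
  have hL : MemLp f 2 ν :=
    MemLp.of_bound hf.aestronglyMeasurable B (Filter.Eventually.of_forall hB)
  have := variance_nonneg f ν
  rw [variance_eq_sub hL] at this
  simpa using this

end Average

/-! ### Deviation of a pure state under a random unitary channel -/

section Channel

variable {ι κ : Type*} [Fintype ι] [DecidableEq ι] [Fintype κ]

/-- The action of a unitary matrix on vectors. -/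
def unitaryAct (U : Matrix.unitaryGroup ι ℂ) (v : EuclideanSpace ℂ ι) : EuclideanSpace ℂ ι :=
  Matrix.toEuclideanLin (U : Matrix ι ι ℂ) v

lemma norm_unitaryAct (U : Matrix.unitaryGroup ι ℂ) (v : EuclideanSpace ℂ ι) :
    ‖unitaryAct U v‖ = ‖v‖ := by
  have h : inner ℂ (unitaryAct U v) (unitaryAct U v) = inner ℂ v v := by
    rw [unitaryAct, ← LinearMap.adjoint_inner_right,
      ← Matrix.toEuclideanLin_conjTranspose_eq_adjoint, ← LinearMap.comp_apply,
      Matrix.toEuclideanLin, ← Matrix.toLpLin_mul]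
    have : (U : Matrix ι ι ℂ).conjTranspose * (U : Matrix ι ι ℂ) = 1 :=
      Matrix.mem_unitaryGroup_iff'.mp U.2
    rw [this]
    simp
  rw [@norm_eq_sqrt_re_inner ℂ, h, ← @norm_eq_sqrt_re_inner ℂ]

lemma conj_ketBra (U : Matrix.unitaryGroup ι ℂ) (u w : EuclideanSpace ℂ ι) :
    (U : Matrix ι ι ℂ) * ketBra u w * (U : Matrix ι ι ℂ).conjTranspose =
      ketBra (unitaryAct U u) (unitaryAct U w) := by
  ext i j
  simp only [Matrix.mul_apply, ketBra_apply, Matrix.conjTranspose_apply, unitaryAct,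
    Matrix.toLpLin_apply, Matrix.mulVec, dotProduct, star_sum, star_mul', Finset.sum_mul_sum]
  rw [Finset.sum_comm]
  refine Finset.sum_congr rfl fun k _ => ?_
  rw [Finset.sum_mul]
  exact Finset.sum_congr rfl fun l _ => by ring

lemma traceNorm_conj_ketBra_le (U : Matrix.unitaryGroup ι ℂ) (u w : EuclideanSpace ℂ ι) :
    traceNorm ((U : Matrix ι ι ℂ) * ketBra u w * (U : Matrix ι ι ℂ).conjTranspose) ≤
      ‖u‖ * ‖w‖ := by
  rw [conj_ketBra]
  refine (traceNorm_ketBra_le _ _).trans ?_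
  rw [norm_unitaryAct, norm_unitaryAct]

lemma ketBra_self_sub_ketBra_self {ι : Type*} (u w : EuclideanSpace ℂ ι) :
    ketBra u u - ketBra w w = ketBra u (u - w) + ketBra (u - w) w := by
  ext i j
  simp
  ring

lemma traceNorm_conj_ketBra_sub_le (U : Matrix.unitaryGroup ι ℂ) {u w : EuclideanSpace ℂ ι}
    (hu : ‖u‖ = 1) (hw : ‖w‖ = 1) :
    traceNorm ((U : Matrix ι ι ℂ) * (ketBra u u - ketBra w w) *
      (U : Matrix ι ι ℂ).conjTranspose) ≤ 2 * ‖u - w‖ := by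
  rw [ketBra_self_sub_ketBra_self, mul_add, add_mul]
  refine (traceNorm_add_le _ _).trans ?_
  have h1 := traceNorm_conj_ketBra_le U u (u - w)
  have h2 := traceNorm_conj_ketBra_le U (u - w) w
  rw [hu] at h1
  rw [hw] at h2
  linarith

lemma traceNorm_randomUnitaryChannel_le [Nonempty κ] (U : κ → Matrix.unitaryGroup ι ℂ)
    (A : Matrix ι ι ℂ) {b : ℝ}
    (h : ∀ k, traceNorm ((U k : Matrix ι ι ℂ) * A * (U k : Matrix ι ι ℂ).conjTranspose) ≤ b) :
    traceNorm (randomUnitaryChannel U A) ≤ b := by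
  refine (traceNorm_smul_le _ _).trans ?_
  have h1 : ‖(1 / (Fintype.card κ : ℂ))‖ = 1 / (Fintype.card κ : ℝ) := by simp
  rw [h1]
  have h2 := (traceNorm_sum_le Finset.univ _).trans (Finset.sum_le_sum fun k _ => h k)
  rw [Finset.sum_const, Finset.card_univ, nsmul_eq_mul] at h2
  have h3 : (0 : ℝ) < Fintype.card κ := by exact_mod_cast Fintype.card_pos
  calc 1 / (Fintype.card κ : ℝ) * _ ≤ 1 / (Fintype.card κ : ℝ) * (Fintype.card κ * b) := by
        gcongr
    _ = b := by field_simp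

lemma randomUnitaryChannel_sub (U : κ → Matrix.unitaryGroup ι ℂ) (A B : Matrix ι ι ℂ) :
    randomUnitaryChannel U (A - B) = randomUnitaryChannel U A - randomUnitaryChannel U B := by
  simp [randomUnitaryChannel, mul_sub, sub_mul, Finset.sum_sub_distrib, smul_sub]

lemma randomUnitaryChannel_sum_smul {α : Type*} (s : Finset α)
    (U : κ → Matrix.unitaryGroup ι ℂ) (c : α → ℂ) (A : α → Matrix ι ι ℂ) :
    randomUnitaryChannel U (∑ a ∈ s, c a • A a) =
      ∑ a ∈ s, c a • randomUnitaryChannel U (A a) := by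
  simp only [randomUnitaryChannel, Finset.mul_sum, Finset.sum_mul, Finset.smul_sum,
    Matrix.mul_smul, Matrix.smul_mul]
  rw [Finset.sum_comm]
  exact Finset.sum_congr rfl fun a _ => Finset.sum_congr rfl fun k _ => smul_comm _ _ _

/-- The trace distance of the image of the pure state `ψ` to the totally mixed state. -/
def pureDeviation (ψ : EuclideanSpace ℂ ι) (U : κ → Matrix.unitaryGroup ι ℂ) : ℝ :=
  traceNorm (randomUnitaryChannel U (ketBra ψ ψ) - (1 / (Fintype.card ι : ℂ)) • 1)

lemma pureDeviation_nonneg (ψ : EuclideanSpace ℂ ι) (U : κ → Matrix.unitaryGroup ι ℂ) :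
    0 ≤ pureDeviation ψ U := traceNorm_nonneg _

lemma traceNorm_one_le : traceNorm (1 : Matrix ι ι ℂ) ≤ Fintype.card ι := by
  refine abs_le_of_sq_le_sq' ?_ (Nat.cast_nonneg _) |>.2
  refine (traceNorm_sq_le _).trans (le_of_eq ?_)
  have : ∀ i j : ι, ‖(1 : Matrix ι ι ℂ) i j‖ ^ 2 = if i = j then 1 else 0 := fun i j => by
    rw [Matrix.one_apply]
    split_ifs <;> simp
  simp [this, sq]

lemma pureDeviation_le_two [Nonempty κ] {ψ : EuclideanSpace ℂ ι} (hψ : ‖ψ‖ = 1)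
    (U : κ → Matrix.unitaryGroup ι ℂ) : pureDeviation ψ U ≤ 2 := by
  refine (traceNorm_sub_le _ _).trans ?_
  have h1 : traceNorm (randomUnitaryChannel U (ketBra ψ ψ)) ≤ 1 :=
    traceNorm_randomUnitaryChannel_le U _ fun k => by
      simpa [hψ] using traceNorm_conj_ketBra_le (U k) ψ ψ
  have h2 : traceNorm ((1 / (Fintype.card ι : ℂ)) • (1 : Matrix ι ι ℂ)) ≤ 1 := by
    refine (traceNorm_smul_le _ _).trans ?_
    have h : ‖(1 / (Fintype.card ι : ℂ))‖ = 1 / (Fintype.card ι : ℝ) := by simp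
    rw [h, one_div_mul_eq_div]
    exact div_le_one_of_le₀ traceNorm_one_le (Nat.cast_nonneg _)
  linarith

lemma pureDeviation_sub_le [Nonempty κ] {φ ψ : EuclideanSpace ℂ ι} (hφ : ‖φ‖ = 1)
    (hψ : ‖ψ‖ = 1) (U : κ → Matrix.unitaryGroup ι ℂ) :
    pureDeviation φ U - pureDeviation ψ U ≤ 2 * ‖φ - ψ‖ := by
  refine (le_abs_self _).trans ((abs_traceNorm_sub_le _ _).trans ?_)
  rw [sub_sub_sub_cancel_right, ← randomUnitaryChannel_sub]
  exact traceNorm_randomUnitaryChannel_le U _ fun k => traceNorm_conj_ketBra_sub_le _ hφ hψ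

lemma pureDeviation_update_sub_le [DecidableEq κ] {ψ : EuclideanSpace ℂ ι} (hψ : ‖ψ‖ = 1)
    (U : κ → Matrix.unitaryGroup ι ℂ) (k : κ) (V : Matrix.unitaryGroup ι ℂ) :
    pureDeviation ψ (Function.update U k V) - pureDeviation ψ U ≤ 2 / Fintype.card κ := by
  refine (le_abs_self _).trans ((abs_traceNorm_sub_le _ _).trans ?_)
  rw [sub_sub_sub_cancel_right, randomUnitaryChannel, randomUnitaryChannel, ← smul_sub,
    ← Finset.sum_sub_distrib, Finset.sum_eq_single k]
  · refine (traceNorm_smul_le _ _).trans ?_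
    have h : ‖(1 / (Fintype.card κ : ℂ))‖ = 1 / (Fintype.card κ : ℝ) := by simp
    rw [h, one_div_mul_eq_div]
    gcongr
    refine (traceNorm_sub_le _ _).trans ?_
    have h1 := traceNorm_conj_ketBra_le (Function.update U k V k) ψ ψ
    have h2 := traceNorm_conj_ketBra_le (U k) ψ ψ
    rw [hψ] at h1 h2
    linarith
  · intro l _ hl
    rw [Function.update_of_ne hl, sub_self]
  · simp

/-- Second countability makes the product σ-algebra on finite tuples of unitaries the Borel one, so
that continuous functions of a tuple are measurable. -/
instance : SecondCountableTopology (Matrix ι ι ℂ) :=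
  inferInstanceAs (SecondCountableTopology (ι → ι → ℂ))

instance : SecondCountableTopology (Matrix.unitaryGroup ι ℂ) :=
  TopologicalSpace.Subtype.secondCountableTopology (· ∈ Matrix.unitaryGroup ι ℂ)

lemma measurable_pureDeviation (ψ : EuclideanSpace ℂ ι) :
    Measurable (pureDeviation ψ : (κ → Matrix.unitaryGroup ι ℂ) → ℝ) := by
  refine Continuous.measurable (continuous_traceNorm.comp ?_)
  unfold randomUnitaryChannel
  fun_prop

lemma spectral_decomposition {ρ : Matrix ι ι ℂ} (hρ : ρ.IsHermitian) :
    ρ = ∑ k, (hρ.eigenvalues k : ℂ) • ketBra (hρ.eigenvectorBasis k) (hρ.eigenvectorBasis k) := by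
  conv_lhs => rw [hρ.spectral_theorem]
  ext i j
  rw [Unitary.conjStarAlgAut_apply, Matrix.mul_apply]
  rw [Matrix.sum_apply]
  refine Finset.sum_congr rfl fun k _ => ?_
  rw [Matrix.mul_diagonal, Matrix.star_apply, Matrix.IsHermitian.eigenvectorUnitary_apply,
    Matrix.IsHermitian.eigenvectorUnitary_apply]
  simp
  ring

/-- By convexity it suffices to check pure states. -/
lemma isRandomizing_of_pureDeviation_le {ε : ℝ} {U : κ → Matrix.unitaryGroup ι ℂ}
    (h : ∀ ψ : EuclideanSpace ℂ ι, ‖ψ‖ = 1 → pureDeviation ψ U ≤ ε) : IsRandomizing ε U := by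
  rintro ρ ⟨hρ, htr⟩
  set p := hρ.isHermitian.eigenvalues
  set q := hρ.isHermitian.eigenvectorBasis
  have hp : ∀ k, 0 ≤ p k := hρ.eigenvalues_nonneg
  have hp1 : ∑ k, (p k : ℂ) = 1 := by rw [← htr, hρ.isHermitian.trace_eq_sum_eigenvalues]; rfl
  have hp1' : ∑ k, p k = 1 := by exact_mod_cast hp1
  have hdec : randomUnitaryChannel U ρ - (1 / (Fintype.card ι : ℂ)) • 1 =
      ∑ k, (p k : ℂ) • (randomUnitaryChannel U (ketBra (q k) (q k)) -
        (1 / (Fintype.card ι : ℂ)) • 1) := by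
    simp only [smul_sub, Finset.sum_sub_distrib]
    rw [← Finset.sum_smul, hp1, one_smul, ← randomUnitaryChannel_sum_smul]
    congr 2
    exact spectral_decomposition hρ.isHermitian
  rw [hdec]
  calc _ ≤ ∑ k, p k * ε := by
        refine (traceNorm_sum_le _ _).trans (Finset.sum_le_sum fun k _ => ?_)
        refine (traceNorm_smul_le _ _).trans ?_
        rw [Complex.norm_real, Real.norm_eq_abs, abs_of_nonneg (hp k)]
        exact mul_le_mul_of_nonneg_left (h _ (q.norm_eq_one k)) (hp k)
    _ = ε := by rw [← Finset.sum_mul, hp1', one_mul]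

end Channel

/-! ### Random families drawn from a 1-design -/

section RandomFamily

variable {ι : Type*} [Fintype ι] [DecidableEq ι]

/-- A measure on the unitary group is a `1`-design if conjugating by a random unitary has the same
expectation as the completely depolarizing map. -/
def IsOneDesign (ν : Measure (Matrix.unitaryGroup ι ℂ)) : Prop :=
  ∀ (A : Matrix ι ι ℂ) (i j : ι),
    ∫ U : Matrix.unitaryGroup ι ℂ,
      ((U : Matrix ι ι ℂ) * A * (U : Matrix ι ι ℂ).conjTranspose) i j ∂ν =
        ((A.trace / Fintype.card ι) • (1 : Matrix ι ι ℂ)) i j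

lemma continuous_conj_apply (A : Matrix ι ι ℂ) (i j : ι) :
    Continuous fun U : Matrix.unitaryGroup ι ℂ =>
      ((U : Matrix ι ι ℂ) * A * (U : Matrix ι ι ℂ).conjTranspose) i j := by
  have : Continuous fun U : Matrix.unitaryGroup ι ℂ =>
      (U : Matrix ι ι ℂ) * A * (U : Matrix ι ι ℂ).conjTranspose := by fun_prop
  exact this.matrix_elem i j

lemma integrable_conj_apply (ν : Measure (Matrix.unitaryGroup ι ℂ)) [IsFiniteMeasure ν]
    (A : Matrix ι ι ℂ) (i j : ι) :
    Integrable (fun U : Matrix.unitaryGroup ι ℂ =>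
      ((U : Matrix ι ι ℂ) * A * (U : Matrix ι ι ℂ).conjTranspose) i j) ν :=
  (continuous_conj_apply A i j).integrable_of_hasCompactSupport (HasCompactSupport.of_compactSpace _)

lemma trace_ketBra {ι : Type*} [Fintype ι] (u : EuclideanSpace ℂ ι) :
    (ketBra u u).trace = (‖u‖ ^ 2 : ℝ) := by
  rw [EuclideanSpace.norm_sq_eq]
  simp [Matrix.trace, Complex.mul_conj']

lemma sum_norm_sq_conj_ketBra (U : Matrix.unitaryGroup ι ℂ) {ψ : EuclideanSpace ℂ ι}
    (hψ : ‖ψ‖ = 1) :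
    ∑ i, ∑ j, ‖((U : Matrix ι ι ℂ) * ketBra ψ ψ * (U : Matrix ι ι ℂ).conjTranspose) i j‖ ^ 2
      = 1 := by
  have h := EuclideanSpace.norm_sq_eq (unitaryAct U ψ)
  rw [norm_unitaryAct, hψ, one_pow] at h
  simp only [conj_ketBra, ketBra_apply, norm_mul, norm_star, mul_pow]
  rw [← Finset.sum_mul_sum, ← h, one_mul]

lemma norm_conj_ketBra_apply_le (U : Matrix.unitaryGroup ι ℂ) {ψ : EuclideanSpace ℂ ι}
    (hψ : ‖ψ‖ = 1) (i j : ι) :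
    ‖((U : Matrix ι ι ℂ) * ketBra ψ ψ * (U : Matrix ι ι ℂ).conjTranspose) i j‖ ≤ 1 := by
  rw [conj_ketBra, ketBra_apply, norm_mul, norm_star]
  have h : ∀ i, ‖unitaryAct U ψ i‖ ≤ 1 := fun i => by
    rw [← hψ, ← norm_unitaryAct U ψ]
    exact PiLp.norm_apply_le _ _
  exact mul_le_one₀ (h i) (norm_nonneg _) (h j)

variable {ν : Measure (Matrix.unitaryGroup ι ℂ)} [IsProbabilityMeasure ν]

/-- The mean square of one entry of the deviation from the totally mixed state. -/
lemma integral_norm_sq_deviation_apply_le (hν : IsOneDesign ν) {ψ : EuclideanSpace ℂ ι}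
    (hψ : ‖ψ‖ = 1) {m : ℕ} (hm : 1 ≤ m) (i j : ι) :
    ∫ U, ‖(randomUnitaryChannel U (ketBra ψ ψ) - (1 / (Fintype.card ι : ℂ)) • 1) i j‖ ^ 2
        ∂(Measure.pi fun _ : Fin m => ν) ≤
      (∫ V : Matrix.unitaryGroup ι ℂ,
        ‖((V : Matrix ι ι ℂ) * ketBra ψ ψ * (V : Matrix ι ι ℂ).conjTranspose) i j‖ ^ 2 ∂ν) / m := by
  set F : Matrix.unitaryGroup ι ℂ → ℂ := fun V =>
    ((V : Matrix ι ι ℂ) * ketBra ψ ψ * (V : Matrix ι ι ℂ).conjTranspose) i j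
  have hF : Continuous F := continuous_conj_apply _ i j
  have hFi : Integrable F ν := integrable_conj_apply ν _ i j
  have hFB : ∀ V, ‖F V‖ ≤ 1 := fun V => norm_conj_ketBra_apply_le V hψ i j
  have hEF : ∫ V, F V ∂ν = ((1 / (Fintype.card ι : ℂ)) • (1 : Matrix ι ι ℂ)) i j := by
    rw [hν, trace_ketBra, hψ]
    simp
  have hre : Measurable fun V => (F V).re := (Complex.continuous_re.comp hF).measurable
  have him : Measurable fun V => (F V).im := (Complex.continuous_im.comp hF).measurable
  have hreB : ∀ V, |(F V).re| ≤ 1 := fun V => (Complex.abs_re_le_norm _).trans (hFB V)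
  have himB : ∀ V, |(F V).im| ≤ 1 := fun V => (Complex.abs_im_le_norm _).trans (hFB V)
  have hEre : ∫ V, (F V).re ∂ν = (∫ V, F V ∂ν).re := integral_re hFi
  have hEim : ∫ V, (F V).im ∂ν = (∫ V, F V ∂ν).im := integral_im hFi
  have h1 := integral_sq_average_sub_le (ν := ν) hre hreB hm
  have h2 := integral_sq_average_sub_le (ν := ν) him himB hm
  -- The variance bound is for real variables, so real and imaginary parts are treated separately.
  have hentry : ∀ U : Fin m → Matrix.unitaryGroup ι ℂ,
      ‖(randomUnitaryChannel U (ketBra ψ ψ) - (1 / (Fintype.card ι : ℂ)) • 1) i j‖ ^ 2 =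
        ((1 / (m : ℝ)) * ∑ k, (F (U k)).re - ∫ V, (F V).re ∂ν) ^ 2 +
        ((1 / (m : ℝ)) * ∑ k, (F (U k)).im - ∫ V, (F V).im ∂ν) ^ 2 := by
    intro U
    have : (randomUnitaryChannel U (ketBra ψ ψ) - (1 / (Fintype.card ι : ℂ)) • 1) i j =
        ((1 / m : ℝ) : ℂ) * ∑ k, F (U k) - ∫ V, F V ∂ν := by
      rw [hEF, Matrix.sub_apply, randomUnitaryChannel, Matrix.smul_apply, Matrix.sum_apply]
      simp [F]
    rw [this, ← Complex.normSq_eq_norm_sq, Complex.normSq_apply, hEre, hEim, Complex.sub_re,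
      Complex.sub_im, Complex.re_ofReal_mul, Complex.im_ofReal_mul, Complex.re_sum,
      Complex.im_sum]
    ring
  have hint : ∀ {a : Matrix.unitaryGroup ι ℂ → ℝ}, Measurable a → (∀ V, |a V| ≤ 1) →
      Integrable (fun U : Fin m → Matrix.unitaryGroup ι ℂ =>
        ((1 / (m : ℝ)) * ∑ k, a (U k) - ∫ V, a V ∂ν) ^ 2) (Measure.pi fun _ : Fin m => ν) := by
    intro a ha haB
    have hs : Measurable fun U : Fin m → Matrix.unitaryGroup ι ℂ => ∑ k, a (U k) :=
      Finset.measurable_sum _ fun k _ => ha.comp (measurable_pi_apply k)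
    refine integrable_of_measurable_of_abs_le
      (B := ((1 / (m : ℝ)) * m + |∫ V, a V ∂ν|) ^ 2) (by fun_prop) fun U => ?_
    rw [abs_pow]
    gcongr
    refine (abs_sub _ _).trans ?_
    gcongr
    rw [abs_mul, abs_of_nonneg (by positivity)]
    gcongr
    refine (Finset.abs_sum_le_sum_abs _ _).trans ?_
    refine (Finset.sum_le_sum fun k _ => haB (U k)).trans ?_
    simp
  have hsq : ∀ {a : Matrix.unitaryGroup ι ℂ → ℝ}, Measurable a → (∀ V, |a V| ≤ 1) →
      Integrable (fun V => a V ^ 2) ν := fun ha haB =>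
    integrable_of_measurable_of_abs_le (B := 1) (by fun_prop) fun V => by
      rw [abs_pow]
      exact pow_le_one₀ (abs_nonneg _) (haB V)
  have hnorm : ∀ V, ‖F V‖ ^ 2 = (F V).re ^ 2 + (F V).im ^ 2 := fun V => by
    rw [← Complex.normSq_eq_norm_sq, Complex.normSq_apply]
    ring
  change _ ≤ (∫ V, ‖F V‖ ^ 2 ∂ν) / m
  simp only [hentry, hnorm]
  rw [integral_add (hint hre hreB) (hint him himB), integral_add (hsq hre hreB) (hsq him himB),
    add_div]
  exact add_le_add h1 h2

/-- The second moment dominates the squared mean. Comparison with the Hilbert–Schmidt norm costs a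
factor `d`, and the entrywise second moments sum to 1 before division by `m`. -/
lemma integral_pureDeviation_le (hν : IsOneDesign ν) {ψ : EuclideanSpace ℂ ι}
    (hψ : ‖ψ‖ = 1) {m : ℕ} (hm : 1 ≤ m) :
    ∫ U, pureDeviation ψ U ∂(Measure.pi fun _ : Fin m => ν) ≤ √(Fintype.card ι / m) := by
  have : Nonempty (Fin m) := ⟨⟨0, hm⟩⟩
  refine Real.le_sqrt_of_sq_le ?_
  have hmeas := measurable_pureDeviation (κ := Fin m) ψ
  have hB : ∀ U : Fin m → Matrix.unitaryGroup ι ℂ, |pureDeviation ψ U| ≤ 2 := fun U => by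
    rw [abs_of_nonneg (pureDeviation_nonneg _ _)]
    exact pureDeviation_le_two hψ U
  refine (sq_integral_le_integral_sq hmeas hB).trans ?_
  set D : (Fin m → Matrix.unitaryGroup ι ℂ) → Matrix ι ι ℂ := fun U =>
    randomUnitaryChannel U (ketBra ψ ψ) - (1 / (Fintype.card ι : ℂ)) • 1
  have hDc : Continuous D := by
    unfold D randomUnitaryChannel
    fun_prop
  have hDi : ∀ i j, Integrable (fun U => ‖D U i j‖ ^ 2) (Measure.pi fun _ : Fin m => ν) :=
    fun i j => by
      have : Continuous fun U => ‖D U i j‖ ^ 2 := by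
        have := hDc.matrix_elem i j
        fun_prop
      exact this.integrable_of_hasCompactSupport (HasCompactSupport.of_compactSpace _)
  have hFi : ∀ i j, Integrable (fun V : Matrix.unitaryGroup ι ℂ =>
      ‖((V : Matrix ι ι ℂ) * ketBra ψ ψ * (V : Matrix ι ι ℂ).conjTranspose) i j‖ ^ 2) ν :=
    fun i j => by
      have : Continuous fun V : Matrix.unitaryGroup ι ℂ =>
          ‖((V : Matrix ι ι ℂ) * ketBra ψ ψ * (V : Matrix ι ι ℂ).conjTranspose) i j‖ ^ 2 := by
        have := continuous_conj_apply (ketBra ψ ψ) i j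
        fun_prop
      exact this.integrable_of_hasCompactSupport (HasCompactSupport.of_compactSpace _)
  calc ∫ U, pureDeviation ψ U ^ 2 ∂(Measure.pi fun _ : Fin m => ν)
      ≤ ∫ U, Fintype.card ι * ∑ i, ∑ j, ‖D U i j‖ ^ 2 ∂(Measure.pi fun _ : Fin m => ν) := by
        refine integral_mono_of_nonneg (Filter.Eventually.of_forall fun U => sq_nonneg _) ?_
          (Filter.Eventually.of_forall fun U => traceNorm_sq_le _)
        exact (integrable_finsetSum _ fun i _ => integrable_finsetSum _ fun j _ =>
          hDi i j).const_mul _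
    _ = Fintype.card ι * ∑ i, ∑ j, ∫ U, ‖D U i j‖ ^ 2 ∂(Measure.pi fun _ : Fin m => ν) := by
        rw [integral_const_mul, integral_finsetSum _ fun i _ => integrable_finsetSum _
          fun j _ => hDi i j]
        congr 1
        exact Finset.sum_congr rfl fun i _ => integral_finsetSum _ fun j _ => hDi i j
    _ ≤ Fintype.card ι * ∑ i, ∑ j, (∫ V : Matrix.unitaryGroup ι ℂ,
        ‖((V : Matrix ι ι ℂ) * ketBra ψ ψ * (V : Matrix ι ι ℂ).conjTranspose) i j‖ ^ 2 ∂ν) / m := by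
        gcongr with i _ j _
        exact integral_norm_sq_deviation_apply_le hν hψ hm i j
    _ = Fintype.card ι * ((∫ V : Matrix.unitaryGroup ι ℂ, ∑ i, ∑ j,
        ‖((V : Matrix ι ι ℂ) * ketBra ψ ψ * (V : Matrix ι ι ℂ).conjTranspose) i j‖ ^ 2 ∂ν) / m) := by
        simp only [← Finset.sum_div]
        rw [integral_finsetSum _ fun i _ => integrable_finsetSum _ fun j _ => hFi i j]
        congr 2
        exact Finset.sum_congr rfl fun i _ => (integral_finsetSum _ fun j _ => hFi i j).symm
    _ = Fintype.card ι / m := by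
        simp only [sum_norm_sq_conj_ketBra _ hψ]
        simp [div_eq_mul_inv]

/-- Concentration of the deviation of a fixed pure state. -/
lemma measure_pureDeviation_ge_le (hν : IsOneDesign ν) {ψ : EuclideanSpace ℂ ι}
    (hψ : ‖ψ‖ = 1) {m : ℕ} (hm : 1 ≤ m) {b δ : ℝ} (hb : √(Fintype.card ι / m) ≤ b) (hδ : 0 ≤ δ) :
    (Measure.pi fun _ : Fin m => ν).real {U | b + δ ≤ pureDeviation ψ U} ≤
      Real.exp (-(δ ^ 2 * m / 2)) := by
  have : Nonempty (Fin m) := ⟨⟨0, hm⟩⟩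
  have hB : ∀ U : Fin m → Matrix.unitaryGroup ι ℂ, |pureDeviation ψ U| ≤ 2 := fun U => by
    rw [abs_of_nonneg (pureDeviation_nonneg _ _)]
    exact pureDeviation_le_two hψ U
  -- With differences at most `c = 2/m`, the sub-Gaussian parameter `m (c/2)²` is `1/m`.
  have hsub := hasSubgaussianMGF_of_bounded_differences (ν := ν) (2 / m) m (pureDeviation ψ)
    (measurable_pureDeviation ψ) ⟨2, hB⟩ fun k U V => by
      simpa using pureDeviation_update_sub_le hψ U k V
  have htail := hsub.measure_ge_le hδ
  have hE := integral_pureDeviation_le hν hψ hm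
  refine (measureReal_mono ?_).trans (htail.trans (Real.exp_le_exp.mpr (le_of_eq ?_)))
  · intro U hU
    simp only [Set.mem_ofPred_eq] at hU ⊢
    linarith
  · have hm0 : (m : ℝ) ≠ 0 := by positivity
    push_cast
    field_simp

/-- A sequence of `m ≥ (37 d / ε²) ln (15 / ε)` independent unitaries drawn from a `1`-design on
`U(d)` is `ε`-randomizing except with probability `e^{-d/2}`. -/
theorem measure_isRandomizing_ge [Nonempty ι] (hν : IsOneDesign ν) {ε : ℝ} (hε : 0 < ε) {m : ℕ}
    (hm : 1 ≤ m) (hmd : 37 * (Fintype.card ι : ℝ) / ε ^ 2 * Real.log (15 / ε) ≤ m) :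
    1 - Real.exp (-(Fintype.card ι : ℝ) / 2) ≤
      (Measure.pi fun _ : Fin m => ν).real {U | IsRandomizing ε U} := by
  have : Nonempty (Fin m) := ⟨⟨0, hm⟩⟩
  set d : ℝ := (Fintype.card ι : ℝ) with hd
  have hd1 : 1 ≤ d := by
    rw [hd]
    exact_mod_cast Fintype.card_pos (α := ι)
  have hm0 : (0 : ℝ) < m := by exact_mod_cast hm
  -- A deviation never exceeds 2, so this case is trivial; below, `ε < 2` gives `15/ε > 7.5 > e²`.
  rcases le_or_gt 2 ε with h2 | h2
  · have : {U : Fin m → Matrix.unitaryGroup ι ℂ | IsRandomizing ε U} = Set.univ :=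
      Set.eq_univ_of_forall fun U => isRandomizing_of_pureDeviation_le fun ψ hψ =>
        (pureDeviation_le_two hψ U).trans h2
    rw [this, probReal_univ]
    linarith [Real.exp_pos (-d / 2)]
  set L := Real.log (15 / ε) with hL
  have hL2 : 2 ≤ L := by
    rw [hL, Real.le_log_iff_exp_le (by positivity)]
    have he : Real.exp 2 = Real.exp 1 ^ 2 := by rw [← Real.exp_nat_mul]; norm_num
    have h3 := Real.exp_one_lt_d9
    have h4 : Real.exp 1 ^ 2 ≤ 2.7182818286 ^ 2 := by gcongr
    rw [he, le_div_iff₀ hε]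
    nlinarith [Real.exp_pos 1]
  have hdL : 37 * d * L ≤ m * ε ^ 2 := by
    have : 37 * d / ε ^ 2 * L = 37 * d * L / ε ^ 2 := by ring
    rwa [this, div_le_iff₀ (by positivity)] at hmd
  -- Passing to a net point costs at most `2 · ε/6 = ε/3`. The budget is `ε/8` for the mean, `ε/2`
  -- for the fluctuation and `ε/3` for the net, in total `23ε/24`.
  obtain ⟨s, hs1, hsnet, hscard⟩ := exists_unit_sphere_net (EuclideanSpace ℂ ι)
    (r := ε / 6) (by positivity)
  have hfin : Module.finrank ℝ (EuclideanSpace ℂ ι) = 2 * Fintype.card ι := by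
    rw [finrank_real_of_complex, finrank_euclideanSpace]
  have hcard : (s.card : ℝ) ≤ Real.exp (2 * d * L) := by
    refine hscard.trans ?_
    have h1 : 1 + 2 / (ε / 6) ≤ 15 / ε := by
      rw [le_div_iff₀ hε]
      field_simp
      linarith
    have h2 : Real.exp (2 * d * L) = (15 / ε) ^ (2 * Fintype.card ι) := by
      rw [← Real.exp_log (show 0 < 15 / ε by positivity), ← Real.exp_nat_mul, ← hL]
      push_cast
      rw [← hd]
    rw [h2, hfin]
    gcongr
  -- From `37 d L ≤ m ε²` and `L ≥ 2`, the ratio `d/m` is at most `ε²/74`, below `ε²/64`.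
  have hb : √(Fintype.card ι / m) ≤ ε / 8 := by
    rw [Real.sqrt_le_left (by positivity), ← hd, div_le_iff₀ hm0]
    nlinarith
  set G := ⋃ φ ∈ s, {U : Fin m → Matrix.unitaryGroup ι ℂ | ε / 8 + ε / 2 ≤ pureDeviation φ U}
  -- Only the bad event `G` needs to be measurable; the randomizing event just has to contain its
  -- complement.
  have hGm : MeasurableSet G := Finset.measurableSet_biUnion _ fun φ _ =>
    measurableSet_le measurable_const (measurable_pureDeviation φ)
  have hG : (Measure.pi fun _ : Fin m => ν).real G ≤ Real.exp (-d / 2) := by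
    refine (measureReal_biUnion_finset_le _ _).trans ?_
    refine (Finset.sum_le_sum fun φ hφ => measure_pureDeviation_ge_le hν (hs1 φ hφ) hm hb
      (δ := ε / 2) (by positivity)).trans ?_
    rw [Finset.sum_const, nsmul_eq_mul]
    refine (mul_le_mul_of_nonneg_right hcard (Real.exp_pos _).le).trans ?_
    rw [← Real.exp_add, Real.exp_le_exp]
    -- The tail exponent `ε² m / 8` is at least `37 d L / 8`. Subtracting `2 d L` leaves `21 d L /
    -- 8`, which exceeds `d/2`.
    nlinarith
  have hsub : Gᶜ ⊆ {U : Fin m → Matrix.unitaryGroup ι ℂ | IsRandomizing ε U} := by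
    intro U hU
    refine isRandomizing_of_pureDeviation_le fun ψ hψ => ?_
    obtain ⟨φ, hφs, hφ⟩ := hsnet ψ hψ
    have h1 : pureDeviation φ U < ε / 8 + ε / 2 := by
      by_contra! hcon
      exact hU (Set.mem_biUnion hφs hcon)
    have h2 := pureDeviation_sub_le hψ (hs1 φ hφs) U
    linarith
  calc 1 - Real.exp (-d / 2) ≤ 1 - (Measure.pi fun _ : Fin m => ν).real G := by gcongr
    _ = (Measure.pi fun _ : Fin m => ν).real Gᶜ := (probReal_compl_eq_one_sub hGm).symm
    _ ≤ _ := measureReal_mono hsub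

end RandomFamily

/-! ### Left invariance implies the 1-design property -/

section Design

variable {ι : Type*} [Fintype ι] [DecidableEq ι]

/-- Substituting `V * U` for `U` in the average shows that `B` is fixed under conjugation by `V`. -/
lemma integral_conj_apply_eq_of_invariant {ν : Measure (Matrix.unitaryGroup ι ℂ)}
    [IsProbabilityMeasure ν] {V : Matrix.unitaryGroup ι ℂ} (hV : ν.map (V * ·) = ν)
    (A : Matrix ι ι ℂ) :
    let B : Matrix ι ι ℂ := Matrix.of fun i j => ∫ U : Matrix.unitaryGroup ι ℂ,
      ((U : Matrix ι ι ℂ) * A * (U : Matrix ι ι ℂ).conjTranspose) i j ∂ν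
    (V : Matrix ι ι ℂ) * B = B * V := by
  intro B
  have hVV : (V : Matrix ι ι ℂ).conjTranspose * (V : Matrix ι ι ℂ) = 1 :=
    Matrix.mem_unitaryGroup_iff'.mp V.2
  suffices h : (V : Matrix ι ι ℂ) * B * (V : Matrix ι ι ℂ).conjTranspose = B by
    conv_rhs => rw [← h]
    rw [mul_assoc, hVV, mul_one]
  have hint := integrable_conj_apply ν A
  have hmul : ∀ U : Matrix.unitaryGroup ι ℂ, ∀ i j,
      (((V * U : Matrix.unitaryGroup ι ℂ) : Matrix ι ι ℂ) * A *
        ((V * U : Matrix.unitaryGroup ι ℂ) : Matrix ι ι ℂ).conjTranspose) i j =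
      ∑ l, ∑ k, (V : Matrix ι ι ℂ) i k *
        ((U : Matrix ι ι ℂ) * A * (U : Matrix ι ι ℂ).conjTranspose) k l *
        star ((V : Matrix ι ι ℂ) j l) := fun U i j => by
    have : ((V * U : Matrix.unitaryGroup ι ℂ) : Matrix ι ι ℂ) * A *
        ((V * U : Matrix.unitaryGroup ι ℂ) : Matrix ι ι ℂ).conjTranspose =
        (V : Matrix ι ι ℂ) * ((U : Matrix ι ι ℂ) * A * (U : Matrix ι ι ℂ).conjTranspose) *
          (V : Matrix ι ι ℂ).conjTranspose := by
      simp [Matrix.mul_assoc]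
    rw [this]
    generalize (U : Matrix ι ι ℂ) * A * (U : Matrix ι ι ℂ).conjTranspose = M
    simp only [Matrix.mul_apply, Finset.sum_mul, Matrix.conjTranspose_apply]
  ext i j
  have hB : B i j = ∫ U : Matrix.unitaryGroup ι ℂ,
      (((V * U : Matrix.unitaryGroup ι ℂ) : Matrix ι ι ℂ) * A *
        ((V * U : Matrix.unitaryGroup ι ℂ) : Matrix ι ι ℂ).conjTranspose) i j ∂ν := by
    change ∫ U : Matrix.unitaryGroup ι ℂ,
      ((U : Matrix ι ι ℂ) * A * (U : Matrix ι ι ℂ).conjTranspose) i j ∂ν = _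
    conv_lhs => rw [← hV]
    exact integral_map (continuous_const_mul V).measurable.aemeasurable
      (continuous_conj_apply A i j).aestronglyMeasurable
  rw [hB]
  simp only [hmul]
  rw [integral_finsetSum _ fun l _ => integrable_finsetSum _ fun k _ =>
    ((hint k l).const_mul _).mul_const _, Matrix.mul_apply]
  refine Finset.sum_congr rfl fun l _ => ?_
  rw [integral_finsetSum _ fun k _ => ((hint k l).const_mul _).mul_const _, Matrix.mul_apply,
    Finset.sum_mul]
  refine Finset.sum_congr rfl fun k _ => ?_
  rw [integral_mul_const, integral_const_mul]
  rfl

/-- A probability measure that is invariant under enough diagonal unitaries to separate the basis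
vectors and enough unitaries permuting the basis vectors is a `1`-design. -/
lemma isOneDesign_of_invariant [Nonempty ι] {ν : Measure (Matrix.unitaryGroup ι ℂ)}
    [IsProbabilityMeasure ν]
    (hdiag : ∀ i j : ι, i ≠ j → ∃ V : Matrix.unitaryGroup ι ℂ, ν.map (V * ·) = ν ∧
      ∃ v : ι → ℂ, (V : Matrix ι ι ℂ) = Matrix.diagonal v ∧ v i ≠ v j)
    (htrans : ∀ i j : ι, ∃ V : Matrix.unitaryGroup ι ℂ, ν.map (V * ·) = ν ∧
      (∀ k, (V : Matrix ι ι ℂ) i k = if k = j then 1 else 0) ∧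
      ∀ k, (V : Matrix ι ι ℂ) k j = if k = i then 1 else 0) :
    IsOneDesign ν := by
  intro A
  set B : Matrix ι ι ℂ := Matrix.of fun i j => ∫ U : Matrix.unitaryGroup ι ℂ,
    ((U : Matrix ι ι ℂ) * A * (U : Matrix ι ι ℂ).conjTranspose) i j ∂ν with hBdef
  have hcomm : ∀ V : Matrix.unitaryGroup ι ℂ, ν.map (V * ·) = ν →
      (V : Matrix ι ι ℂ) * B = B * V := fun V hV => integral_conj_apply_eq_of_invariant hV A
  have hoff : ∀ i j, i ≠ j → B i j = 0 := fun i j hij => by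
    obtain ⟨V, hV, v, hv, hne⟩ := hdiag i j hij
    have h := congrFun (congrFun (hcomm V hV) i) j
    rw [hv, Matrix.diagonal_mul, Matrix.mul_diagonal] at h
    by_contra h0
    exact hne (mul_right_cancel₀ h0 (h.trans (mul_comm _ _)))
  -- Comparing the `(i, j)` entries of `V * B` and `B * V`, where `V` sends basis vector `j` to
  -- basis vector `i`, yields `B j j` and `B i i`.
  have heq : ∀ i j, B i i = B j j := fun i j => by
    obtain ⟨V, hV, hrow, hcol⟩ := htrans i j
    have h := congrFun (congrFun (hcomm V hV) i) j
    rw [Matrix.mul_apply, Matrix.mul_apply] at h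
    simp only [hrow, hcol] at h
    simpa using h.symm
  have htr : B.trace = A.trace := by
    simp only [Matrix.trace, Matrix.diag_apply, hBdef, Matrix.of_apply]
    rw [← integral_finsetSum _ fun i _ => integrable_conj_apply ν A i i]
    have : ∀ U : Matrix.unitaryGroup ι ℂ,
        ∑ i, ((U : Matrix ι ι ℂ) * A * (U : Matrix ι ι ℂ).conjTranspose) i i = ∑ i, A i i :=
      fun U => by
        have h1 : (U : Matrix ι ι ℂ).conjTranspose * (U : Matrix ι ι ℂ) = 1 :=
          Matrix.mem_unitaryGroup_iff'.mp U.2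
        change Matrix.trace _ = Matrix.trace A
        rw [Matrix.trace_mul_comm, ← mul_assoc, h1, one_mul]
    simp [this]
  have hcard : (Fintype.card ι : ℂ) ≠ 0 := by exact_mod_cast Fintype.card_ne_zero
  intro i j
  change B i j = _
  rw [Matrix.smul_apply, Matrix.one_apply]
  split_ifs with hij
  · subst hij
    have : B.trace = Fintype.card ι * B i i := by
      have h : B.trace = ∑ _k : ι, B i i := Finset.sum_congr rfl fun k _ => heq k i
      rw [h]
      simp
    rw [← htr, this]
    simp [hcard]
  · rw [hoff i j hij]
    simp

end Design

/-! ### Haar measure is a 1-design -/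

section Haar

instance isProbabilityMeasure_unitaryHaar (d : ℕ) : IsProbabilityMeasure (unitaryHaar d) :=
  ⟨by
    have h := Measure.haarMeasure_self
      (K₀ := (⊤ : TopologicalSpace.PositiveCompacts (Matrix.unitaryGroup (Fin d) ℂ)))
    simpa [unitaryHaar] using h⟩

lemma map_mul_left_unitaryHaar (d : ℕ) (V : Matrix.unitaryGroup (Fin d) ℂ) :
    (unitaryHaar d).map (V * ·) = unitaryHaar d := by
  unfold unitaryHaar
  exact map_mul_left_eq_self _ V

lemma isOneDesign_unitaryHaar (d : ℕ) [NeZero d] : IsOneDesign (unitaryHaar d) := by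
  refine isOneDesign_of_invariant (fun i j hij => ?_) fun i j => ?_
  · refine ⟨⟨Matrix.diagonal fun k => if k = i then -1 else 1, ?_⟩,
      map_mul_left_unitaryHaar d _, _, rfl, ?_⟩
    · rw [Matrix.mem_unitaryGroup_iff, Matrix.star_eq_conjTranspose,
        Matrix.diagonal_conjTranspose, Matrix.diagonal_mul_diagonal, ← Matrix.diagonal_one]
      congr 1
      ext k
      by_cases hk : k = i <;> simp [hk]
    · simp [hij.symm]
      norm_num
  · refine ⟨⟨Matrix.of fun a b => if Equiv.swap i j a = b then 1 else 0, ?_⟩,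
      map_mul_left_unitaryHaar d _, fun k => ?_, fun k => ?_⟩
    · rw [Matrix.mem_unitaryGroup_iff]
      ext a b
      simp [Matrix.mul_apply, Matrix.one_apply, eq_comm]
    · simp [eq_comm]
    · have : Equiv.swap i j k = j ↔ k = i := by
        rw [Equiv.swap_apply_eq_iff, Equiv.swap_apply_right]
      simp [this]

end Haar

/-! ### The uniform Pauli measure is a 1-design -/

section Pauli

lemma pauliMatrix_mul (a b : Fin 4) : ∃ c u : Fin 4,
    pauliMatrix a * pauliMatrix b = Complex.I ^ (c : ℕ) • pauliMatrix u := by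
  -- The multiplication table: exponents of the phase `i` first, then the index of the resulting
  -- Pauli matrix.
  refine ⟨(![![0, 0, 0, 0], ![0, 0, 1, 3], ![0, 3, 0, 1], ![0, 1, 3, 0]] :
    Fin 4 → Fin 4 → Fin 4) a b, (![![0, 1, 2, 3], ![1, 0, 3, 2], ![2, 3, 0, 1], ![3, 2, 1, 0]] :
    Fin 4 → Fin 4 → Fin 4) a b, ?_⟩
  fin_cases a <;> fin_cases b <;> ext i j <;> fin_cases i <;> fin_cases j <;>
    simp [pauliMatrix, Matrix.mul_apply, Complex.I_pow_three]

lemma pauliMatrix_mul_self (a : Fin 4) : pauliMatrix a * pauliMatrix a = 1 := by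
  fin_cases a <;> ext i j <;> fin_cases i <;> fin_cases j <;>
    simp [pauliMatrix, Matrix.mul_apply]

lemma star_pauliMatrix_apply (a : Fin 4) (i j : Fin 2) :
    star (pauliMatrix a i j) = pauliMatrix a j i := by
  fin_cases a <;> fin_cases i <;> fin_cases j <;> simp [pauliMatrix]

variable {n : ℕ}

lemma pauliString_mul_apply (s t : Fin n → Fin 4) (x y : Fin n → Fin 2) :
    (pauliString s * pauliString t) x y =
      ∏ k, (pauliMatrix (s k) * pauliMatrix (t k)) (x k) (y k) := by
  simp only [Matrix.mul_apply, pauliString, Matrix.of_apply, ← Finset.prod_mul_distrib]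
  rw [Finset.prod_univ_sum, Fintype.piFinset_univ]

lemma prod_ite_apply_eq (x y : Fin n → Fin 2) :
    (∏ k, if x k = y k then (1 : ℂ) else 0) = if x = y then 1 else 0 := by
  rw [Finset.prod_ite_zero]
  simp [funext_iff]

lemma pauliString_mul_self (s : Fin n → Fin 4) : pauliString s * pauliString s = 1 := by
  ext x y
  simp only [pauliString_mul_apply, pauliMatrix_mul_self, Matrix.one_apply]
  exact prod_ite_apply_eq x y

lemma star_pauliString (s : Fin n → Fin 4) : star (pauliString s) = pauliString s := by
  ext x y
  simp only [Matrix.star_apply, pauliString, Matrix.of_apply, star_prod, star_pauliMatrix_apply]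

lemma pauliString_mul (s t : Fin n → Fin 4) : ∃ (c : ℕ) (u : Fin n → Fin 4),
    pauliString s * pauliString t = Complex.I ^ c • pauliString u := by
  choose c u h using pauliMatrix_mul
  refine ⟨∑ k, (c (s k) (t k) : ℕ), fun k => u (s k) (t k), ?_⟩
  ext x y
  rw [pauliString_mul_apply]
  simp [h, Finset.prod_mul_distrib, pauliString, Finset.prod_pow_eq_pow_sum]

/-- The Pauli string as a unitary operator. -/
def unitaryPauliString (s : Fin n → Fin 4) : Matrix.unitaryGroup (Fin n → Fin 2) ℂ :=
  ⟨pauliString s, by rw [Matrix.mem_unitaryGroup_iff, star_pauliString, pauliString_mul_self]⟩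

lemma unitaryPauliString_mem (s : Fin n → Fin 4) : unitaryPauliString s ∈ pauliOperators n :=
  ⟨0, s, by simp [unitaryPauliString]⟩

lemma finite_pauliOperators (n : ℕ) : (pauliOperators n).Finite := by
  have h := (Set.finite_range fun p : Fin 4 × (Fin n → Fin 4) =>
    Complex.I ^ (p.1 : ℕ) • pauliString p.2).preimage
      (Subtype.val_injective (p := (· ∈ Matrix.unitaryGroup (Fin n → Fin 2) ℂ))).injOn
  exact h.subset fun P ⟨a, s, hP⟩ => ⟨(a, s), hP.symm⟩

lemma unitaryPauliString_mul_mem (s : Fin n → Fin 4) {P : Matrix.unitaryGroup (Fin n → Fin 2) ℂ}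
    (hP : P ∈ pauliOperators n) : unitaryPauliString s * P ∈ pauliOperators n := by
  obtain ⟨a, t, hP⟩ := hP
  obtain ⟨c, u, h⟩ := pauliString_mul s t
  refine ⟨⟨(a + c) % 4, Nat.mod_lt _ (by norm_num)⟩, u, ?_⟩
  change pauliString s * (P : Matrix (Fin n → Fin 2) (Fin n → Fin 2) ℂ) = _
  rw [hP, Matrix.mul_smul, h, smul_smul, ← pow_add, Complex.I_pow_eq_pow_mod]

lemma unitaryPauliString_mul_mem_iff (s : Fin n → Fin 4)
    (P : Matrix.unitaryGroup (Fin n → Fin 2) ℂ) :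
    unitaryPauliString s * P ∈ pauliOperators n ↔ P ∈ pauliOperators n := by
  refine ⟨fun h => ?_, unitaryPauliString_mul_mem s⟩
  have h1 : unitaryPauliString s * unitaryPauliString s = 1 :=
    Subtype.ext (pauliString_mul_self s)
  have := unitaryPauliString_mul_mem s h
  rwa [← mul_assoc, h1, one_mul] at this

instance isProbabilityMeasure_uniformPauli (n : ℕ) : IsProbabilityMeasure (uniformPauli n) :=
  isProbabilityMeasure_uniformOn (finite_pauliOperators n) ⟨_, unitaryPauliString_mem 0⟩

/-- Left multiplication by a Pauli string is a bijection preserving the finite set of Pauli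
operators, and counting measure is translation invariant. -/
lemma map_mul_left_uniformPauli (s : Fin n → Fin 4) :
    (uniformPauli n).map (unitaryPauliString s * ·) = uniformPauli n := by
  have hm : Measurable (unitaryPauliString s * ·) :=
    (continuous_const_mul (unitaryPauliString s)).measurable
  ext t ht
  have hS := (finite_pauliOperators n).measurableSet
  rw [Measure.map_apply hm ht, uniformPauli, uniformOn, cond_apply hS, cond_apply hS]
  congr 1
  have : pauliOperators n ∩ (unitaryPauliString s * ·) ⁻¹' t =
      (unitaryPauliString s * ·) ⁻¹' (pauliOperators n ∩ t) := by
    ext P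
    simp [unitaryPauliString_mul_mem_iff]
  rw [this, measure_preimage_mul]

lemma ae_mem_pauliOperators (n : ℕ) : ∀ᵐ P ∂uniformPauli n, P ∈ pauliOperators n :=
  ae_cond_mem (finite_pauliOperators n).measurableSet

lemma isOneDesign_uniformPauli (n : ℕ) : IsOneDesign (uniformPauli n) := by
  refine isOneDesign_of_invariant (fun x y hxy => ?_) fun x y => ?_
  -- A single `Z` at a qubit where `x` and `y` differ separates the two basis vectors.
  · obtain ⟨j, hj⟩ := Function.ne_iff.mp hxy
    refine ⟨unitaryPauliString (Function.update 0 j 3), map_mul_left_uniformPauli _,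
      fun z => if z j = 0 then 1 else -1, ?_, ?_⟩
    · have h3 : ∀ a b : Fin 2, pauliMatrix 3 a b =
          (if a = 0 then 1 else -1) * if a = b then 1 else 0 := fun a b => by
        fin_cases a <;> fin_cases b <;> simp [pauliMatrix]
      have h0 : ∀ a b : Fin 2, pauliMatrix 0 a b = if a = b then 1 else 0 := fun a b => by
        fin_cases a <;> fin_cases b <;> simp [pauliMatrix]
      ext z w
      have hk : ∀ k, pauliMatrix (Function.update (0 : Fin n → Fin 4) j 3 k) (z k) (w k) =
          (if k = j then (if z j = 0 then (1 : ℂ) else -1) else 1) *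
            if z k = w k then 1 else 0 := fun k => by
        rcases eq_or_ne k j with rfl | hkj
        · simp [h3]
        · simp [hkj, h0]
      change ∏ k, pauliMatrix (Function.update (0 : Fin n → Fin 4) j 3 k) (z k) (w k) = _
      simp only [hk, Finset.prod_mul_distrib, prod_ite_apply_eq, Matrix.diagonal_apply]
      simp
    · have h : ∀ a b : Fin 2, a ≠ b →
          (if a = 0 then (1 : ℂ) else -1) ≠ if b = 0 then 1 else -1 := fun a b hab => by
        fin_cases a <;> fin_cases b <;> first | exact absurd rfl hab | (simp; norm_num)
      exact h _ _ hj
  -- Placing `X` exactly where `x` and `y` differ exchanges the two basis vectors, with no phase.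
  · refine ⟨unitaryPauliString fun k => if x k = y k then 0 else 1, map_mul_left_uniformPauli _,
      fun w => ?_, fun w => ?_⟩
    · have h : ∀ a b c : Fin 2, pauliMatrix (if a = c then 0 else 1) a b =
          if b = c then 1 else 0 := fun a b c => by
        fin_cases a <;> fin_cases b <;> fin_cases c <;> simp [pauliMatrix]
      rw [← prod_ite_apply_eq]
      change ∏ k, pauliMatrix (if x k = y k then 0 else 1) (x k) (w k) = _
      exact Finset.prod_congr rfl fun k _ => h _ _ _
    · have h : ∀ a b c : Fin 2, pauliMatrix (if a = c then 0 else 1) b c =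
          if b = a then 1 else 0 := fun a b c => by
        fin_cases a <;> fin_cases b <;> fin_cases c <;> simp [pauliMatrix]
      rw [← prod_ite_apply_eq]
      change ∏ k, pauliMatrix (if x k = y k then 0 else 1) (w k) (y k) = _
      exact Finset.prod_congr rfl fun k _ => h _ _ _

end Pauli

/-! ### Key length -/

section KeyLength

/-- Since `ln(15/ε) ≤ 15/ε`, it suffices that `2^k ≥ 555 d / ε³`, and 555 is rounded up to `2^10`.
Taking logarithms and rounding up adds at most 11, absorbed by `11 log₂(1/ε)` because `ε ≤ 1/2`;
together with the 3 from `ε⁻³` this gives 14. -/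
lemma exists_key_length {d ε : ℝ} (hd : 1 ≤ d) (hε : 0 < ε) (hε2 : ε ≤ 1 / 2) :
    ∃ k : ℕ, (k : ℝ) ≤ Real.logb 2 d + 14 * Real.logb 2 (1 / ε) ∧
      37 * d / ε ^ 2 * Real.log (15 / ε) ≤ ((2 ^ k : ℕ) : ℝ) := by
  have hd0 : 0 < d := by linarith
  have hL : 1 ≤ Real.logb 2 (1 / ε) := by
    rw [Real.le_logb_iff_rpow_le one_lt_two (by positivity), Real.rpow_one, le_div_iff₀ hε]
    linarith
  have hx : Real.logb 2 (1024 * d * (1 / ε) ^ 3) =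
      10 + Real.logb 2 d + 3 * Real.logb 2 (1 / ε) := by
    have h10 : Real.logb 2 1024 = 10 := by
      rw [show (1024 : ℝ) = 2 ^ (10 : ℕ) by norm_num, Real.logb_pow, Real.logb_self_eq_one
        one_lt_two]
      norm_num
    rw [Real.logb_mul (by positivity) (by positivity), Real.logb_mul (by norm_num) hd0.ne',
      Real.logb_pow, h10]
    norm_num
  have hd' : 0 ≤ Real.logb 2 d := Real.logb_nonneg one_lt_two hd
  refine ⟨⌈Real.logb 2 (1024 * d * (1 / ε) ^ 3)⌉₊, ?_, ?_⟩
  · have := Nat.ceil_lt_add_one (a := Real.logb 2 (1024 * d * (1 / ε) ^ 3)) (by rw [hx]; linarith)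
    linarith
  · have h1 : Real.log (15 / ε) ≤ 15 / ε :=
      (Real.log_le_sub_one_of_pos (by positivity)).trans (by linarith)
    calc 37 * d / ε ^ 2 * Real.log (15 / ε) ≤ 37 * d / ε ^ 2 * (15 / ε) := by gcongr
      _ = 555 * d * (1 / ε) ^ 3 := by field_simp; norm_num
      _ ≤ 1024 * d * (1 / ε) ^ 3 := by gcongr; norm_num
      _ = (2 : ℝ) ^ Real.logb 2 (1024 * d * (1 / ε) ^ 3) :=
        (Real.rpow_logb two_pos (by norm_num) (by positivity)).symm
      _ ≤ (2 : ℝ) ^ (⌈Real.logb 2 (1024 * d * (1 / ε) ^ 3)⌉₊ : ℝ) :=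
        Real.rpow_le_rpow_of_exponent_le one_le_two (Nat.le_ceil _)
      _ = _ := by rw [Real.rpow_natCast]; push_cast; rfl

variable {ι : Type*} [Fintype ι] [DecidableEq ι]

lemma isRandomizing_comp_equiv {κ κ' : Type*} [Fintype κ] [Fintype κ'] {ε : ℝ}
    {U : κ → Matrix.unitaryGroup ι ℂ} (hU : IsRandomizing ε U) (e : κ' ≃ κ) :
    IsRandomizing ε (U ∘ e) := fun ρ hρ => by
  have : randomUnitaryChannel (U ∘ e) ρ = randomUnitaryChannel U ρ := by
    rw [randomUnitaryChannel, randomUnitaryChannel, Fintype.card_congr e]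
    congr 1
    exact e.sum_comp fun k => (U k : Matrix ι ι ℂ) * ρ * (U k : Matrix ι ι ℂ).conjTranspose
  rw [this]
  exact hU ρ hρ

/-- The randomizing event has positive probability, so it is not contained in the null event that
some member falls outside `S`. -/
lemma exists_isRandomizing_family [Nonempty ι] {ν : Measure (Matrix.unitaryGroup ι ℂ)}
    [IsProbabilityMeasure ν] (hν : IsOneDesign ν) {S : Set (Matrix.unitaryGroup ι ℂ)}
    (hS : ∀ᵐ V ∂ν, V ∈ S) {ε : ℝ} (hε : 0 < ε) (hε2 : ε ≤ 1 / 2) :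
    ∃ k : ℕ, (k : ℝ) ≤ Real.logb 2 (Fintype.card ι) + 14 * Real.logb 2 (1 / ε) ∧
      ∃ U : (Fin k → Bool) → Matrix.unitaryGroup ι ℂ, (∀ key, U key ∈ S) ∧ IsRandomizing ε U := by
  have hd : (1 : ℝ) ≤ Fintype.card ι := by exact_mod_cast Fintype.card_pos (α := ι)
  obtain ⟨k, hk, hm⟩ := exists_key_length hd hε hε2
  refine ⟨k, hk, ?_⟩
  have hprob := measure_isRandomizing_ge hν hε Nat.one_le_two_pow hm
  have hpos : 0 < 1 - Real.exp (-(Fintype.card ι : ℝ) / 2) := by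
    rw [sub_pos, Real.exp_lt_one_iff]
    linarith
  have hae : ∀ᵐ U ∂(Measure.pi fun _ : Fin (2 ^ k) => ν), ∀ l, U l ∈ S :=
    ae_all_iff.mpr fun l =>
      (measurePreserving_eval (fun _ : Fin (2 ^ k) => ν) l).quasiMeasurePreserving.ae hS
  obtain ⟨U, hU, hUS⟩ : ∃ U : Fin (2 ^ k) → Matrix.unitaryGroup ι ℂ,
      IsRandomizing ε U ∧ ∀ l, U l ∈ S := by
    by_contra! hcon
    have hzero : (Measure.pi fun _ : Fin (2 ^ k) => ν) {U | IsRandomizing ε U} = 0 := by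
      refine measure_mono_null (fun U hU => ?_) (ae_iff.mp hae)
      obtain ⟨l, hl⟩ := hcon U hU
      exact fun h => hl (h l)
    rw [measureReal_def, hzero] at hprob
    simp only [ENNReal.toReal_zero] at hprob
    linarith
  have e : (Fin k → Bool) ≃ Fin (2 ^ k) := Fintype.equivFinOfCardEq (by simp)
  exact ⟨U ∘ e, fun key => hUS _, isRandomizing_comp_equiv hU e⟩

end KeyLength

end

theorem theorem1 :
    -- `m ≥ (37 d / ε²) ln (15 / ε)` independent Haar-random unitaries
    (∀ (d : ℕ), 1 ≤ d → ∀ (ε : ℝ), 0 < ε → ∀ (m : ℕ), 1 ≤ m →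
      37 * (d : ℝ) / ε ^ 2 * Real.log (15 / ε) ≤ (m : ℝ) →
      1 - Real.exp (-(d : ℝ) / 2) ≤
        (Measure.pi fun _ : Fin m => unitaryHaar d).real
          {U : Fin m → Matrix.unitaryGroup (Fin d) ℂ | IsRandomizing ε U}) ∧
    -- `log d + O(log (1 / ε))` bits of key suffice
    (∃ C : ℝ, ∀ (d : ℕ), 1 ≤ d → ∀ (ε : ℝ), 0 < ε → ε ≤ 1 / 2 →
      ∃ k : ℕ, (k : ℝ) ≤ Real.logb 2 (d : ℝ) + C * Real.logb 2 (1 / ε) ∧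
        ∃ U : (Fin k → Bool) → Matrix.unitaryGroup (Fin d) ℂ, IsRandomizing ε U) ∧
    -- the same for `d = 2 ^ n` with uniformly random Pauli operators
    (∀ (n : ℕ) (ε : ℝ), 0 < ε → ∀ (m : ℕ), 1 ≤ m →
      37 * (2 : ℝ) ^ n / ε ^ 2 * Real.log (15 / ε) ≤ (m : ℝ) →
      1 - Real.exp (-(2 : ℝ) ^ n / 2) ≤
        (Measure.pi fun _ : Fin m => uniformPauli n).real
          {P : Fin m → Matrix.unitaryGroup (Fin n → Fin 2) ℂ | IsRandomizing ε P}) ∧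
    (∃ C : ℝ, ∀ (n : ℕ) (ε : ℝ), 0 < ε → ε ≤ 1 / 2 →
      ∃ k : ℕ, (k : ℝ) ≤ (n : ℝ) + C * Real.logb 2 (1 / ε) ∧
        ∃ P : (Fin k → Bool) → Matrix.unitaryGroup (Fin n → Fin 2) ℂ,
          (∀ key, P key ∈ pauliOperators n) ∧ IsRandomizing ε P) := by
  refine ⟨fun d hd ε hε m hm hmd => ?_, ⟨14, fun d hd ε hε hε2 => ?_⟩, fun n ε hε m hm hmd => ?_,
    ⟨14, fun n ε hε hε2 => ?_⟩⟩
  · have : NeZero d := ⟨by omega⟩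
    simpa using measure_isRandomizing_ge (isOneDesign_unitaryHaar d) hε hm (by simpa using hmd)
  · have : NeZero d := ⟨by omega⟩
    obtain ⟨k, hk, U, -, hU⟩ := exists_isRandomizing_family (isOneDesign_unitaryHaar d)
      (S := Set.univ) (Filter.Eventually.of_forall Set.mem_univ) hε hε2
    exact ⟨k, by simpa using hk, U, hU⟩
  · simpa using measure_isRandomizing_ge (isOneDesign_uniformPauli n) hε hm (by simpa using hmd)
  · obtain ⟨k, hk, P, hP, hPr⟩ := exists_isRandomizing_family (isOneDesign_uniformPauli n)
      (ae_mem_pauliOperators n) hε hε2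
    refine ⟨k, ?_, P, hP, hPr⟩
    have hn : Real.logb 2 (Fintype.card (Fin n → Fin 2)) = n := by
      simp [Real.logb_pow]
    rwa [hn] at hk
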